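/- Let $\mu\in C^1(\mathbb R)\cap L^\infty(\mathbb R)$ be even with $\mu'<0$ on $(0,\infty)$ and $\mu(\xi)=0$ for a (necessarily unique) $\xi>0$, let $f\in L^1(\mathbb R)\cap L^\infty(\mathbb R)\cap C(\mathbb R)$ be odd with $f>0$ on $(0,\infty)$, and let $a>0$. For $\epsilon>0$ and $u\in H^1(\mathbb R)$ put $$E_\epsilon(u)=\int_{\mathbb R}\Big(\frac{\epsilon}{2}|u'|^2-\frac{1}{2\epsilon}\mu u^2+\frac{1}{4\epsilon}u^4-a f u\Big)\,dx .$$ Let $\mu_1:=\mu'(\xi)<0$ and $\alpha:=\frac{a f(\xi)}{\sqrt2\,\mu_1}<0$, and for a function $v_\epsilon$ on $\mathbb R$ let $$w_\epsilon^{\pm}(s)=\pm2^{-1/2}(-\mu_1\epsilon)^{-1/3}\,v_\epsilon\Big(\pm\xi\pm\epsilon^{2/3}\frac{s}{(-\mu_1)^{1/3}}\Big).$$ A solution $y\in C^2(\mathbb R)$ of the second Painlevé equation $y''-sy-2y^3-\alpha=0$ on $\mathbb R$ is called minimal if $E_{\mathrm{P_{II}}}(y,\operatorname{supp}\phi)\le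 E_{\mathrm{P_{II}}}(y+\phi,\operatorname{supp}\phi)$ for all $\phi\in C_0^\infty(\mathbb R)$, where $E_{\mathrm{P_{II}}}(u,I)=\int_I\big(\tfrac12|u'|^2+\tfrac12su^2+\tfrac12u^4+\alpha u\big)\,ds$. Then there is exactly one minimal solution $y$ of this equation that is positive, satisfies $y'<0$ on $\mathbb R$, and has the asymptotics $y(s)\sim|\alpha|/s$ as $s\to+\infty$ and $y(s)\sim\sqrt{|s|/2}$ as $s\to-\infty$. Moreover: (1) if, for all sufficiently small $\epsilon>0$, $v_\epsilon$ is (the continuous representative of) a global minimizer of $E_\epsilon$ over $H^1(\mathbb R)$ with $v_\epsilon\ge0$ on $[0,\infty)$, then $w_\epsilon^+\to y$ in $C^1_{\mathrm{loc}}(\mathbb R)$ as $\epsilon\to0^+$; (2) if, for all sufficiently small $\epsilon>0$, $v_\epsilon$ is (the continuous representative of) a global minimizer of $E_\epsilon$ over $H^1(\mathbb R)$ with $v_\epsilon\le0$ on $(-\infty,0]$, then $w_\epsilon^-\to y$ in $C^1_{\mathrm{loc}}(\mathbb R)$ as $\epsilon\to0^+$. -/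

import Mathlib

open MeasureTheory Filter Topology Asymptotics
open scoped ContDiff

noncomputable section

/-- Standing assumptions on the coefficients: `μ ∈ C¹ ∩ L^∞` is even, `μ' < 0` on `(0, ∞)`,
`ξ > 0` is the (then unique) positive zero of `μ`; `f ∈ L¹ ∩ L^∞ ∩ C` is odd and positive
on `(0, ∞)`. -/
structure AdmissibleData (μ f : ℝ → ℝ) (ξ : ℝ) : Prop where
  contDiff_mu : ContDiff ℝ 1 μ
  bounded_mu : MemLp μ ⊤ volume
  even_mu : ∀ x, μ (-x) = μ x
  deriv_mu_neg : ∀ x, 0 < x → deriv μ x < 0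
  xi_pos : 0 < ξ
  mu_xi : μ ξ = 0
  integrable_f : Integrable f volume
  bounded_f : MemLp f ⊤ volume
  continuous_f : Continuous f
  odd_f : ∀ x, f (-x) = -f x
  f_pos : ∀ x, 0 < x → 0 < f x

/-- `u ∈ H¹(ℝ)` with weak derivative `g`: both are in `L²(ℝ)` and
`∫ u φ' = -∫ g φ` for every test function `φ`. -/
structure IsH1WithWeakDeriv (u g : ℝ → ℝ) : Prop where
  memLp : MemLp u 2 volume
  memLp_deriv : MemLp g 2 volume
  weak_deriv : ∀ φ : ℝ → ℝ, ContDiff ℝ ∞ φ → HasCompactSupport φ →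
    ∫ x, u x * deriv φ x = -∫ x, g x * φ x

/-- The energy `E(u)`, where `g` is the weak derivative of `u`. -/
def energy (μ f : ℝ → ℝ) (a ε : ℝ) (u g : ℝ → ℝ) : ℝ :=
  ∫ x, (ε / 2 * (g x) ^ 2 - 1 / (2 * ε) * μ x * (u x) ^ 2
    + 1 / (4 * ε) * (u x) ^ 4 - a * f x * u x)

/-- `v` is (the continuous representative of) a global minimizer of `E` over `H¹(ℝ)`. -/
def IsGlobalMinimizer (μ f : ℝ → ℝ) (a ε : ℝ) (v : ℝ → ℝ) : Prop :=
  Continuous v ∧ ∃ g, IsH1WithWeakDeriv v g ∧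
    ∀ u h, IsH1WithWeakDeriv u h → energy μ f a ε v g ≤ energy μ f a ε u h

/-- `y` is a classical solution of `y'' - s y - 2 y³ - α = 0` on `ℝ`. -/
def IsPainleveIISolution (α : ℝ) (y : ℝ → ℝ) : Prop :=
  ContDiff ℝ 2 y ∧ ∀ s, deriv (deriv y) s - s * y s - 2 * (y s) ^ 3 - α = 0

/-- The energy associated with the second Painlevé equation, on the set `I`. -/
def painleveEnergy (α : ℝ) (u : ℝ → ℝ) (I : Set ℝ) : ℝ :=
  ∫ s in I, (1 / 2 * (deriv u s) ^ 2 + 1 / 2 * s * (u s) ^ 2 + 1 / 2 * (u s) ^ 4 + α * u s)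

/-- Minimal solutions: compactly supported smooth perturbations do not lower the energy. -/
def IsMinimalPainleveIISolution (α : ℝ) (y : ℝ → ℝ) : Prop :=
  IsPainleveIISolution α y ∧
    ∀ φ : ℝ → ℝ, ContDiff ℝ ∞ φ → HasCompactSupport φ →
      painleveEnergy α y (tsupport φ) ≤ painleveEnergy α (fun s => y s + φ s) (tsupport φ)

/-- For `α < 0`: the positive, strictly decreasing minimal solution with
`y(s) ∼ |α| / s` at `+∞` and `y(s) ∼ √(|s| / 2)` at `-∞`. -/
structure IsPositiveDecreasingPainleve (α : ℝ) (y : ℝ → ℝ) : Prop where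
  minimal : IsMinimalPainleveIISolution α y
  pos : ∀ s, 0 < y s
  deriv_neg : ∀ s, deriv y s < 0
  asymp_atTop : y ~[atTop] fun s => |α| / s
  asymp_atBot : y ~[atBot] fun s => √(|s| / 2)

/-- The rescaled profile
`w(s) = σ 2^{-1/2} (-μ'(ξ) ε)^{-1/3} v(σ ξ + σ ε^{2/3} s / (-μ'(ξ))^{1/3})`;
`σ = 1` gives `w⁺` and `σ = -1` gives `w⁻`. -/
def rescaledProfile (μ : ℝ → ℝ) (ξ σ ε : ℝ) (v : ℝ → ℝ) (s : ℝ) : ℝ :=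
  σ * (2 : ℝ) ^ (-(1 / 2) : ℝ) * (-(deriv μ ξ) * ε) ^ (-(1 / 3) : ℝ) *
    v (σ * ξ + σ * ε ^ (2 / 3 : ℝ) * (s / (-(deriv μ ξ)) ^ (1 / 3 : ℝ)))

/-- Convergence `w ε → y` in `C¹_loc(ℝ)` as `ε → 0⁺`. -/
def TendstoC1Loc (w : ℝ → ℝ → ℝ) (y : ℝ → ℝ) : Prop :=
  ContDiff ℝ 1 y ∧ (∀ᶠ ε in 𝓝[>] (0 : ℝ), ContDiff ℝ 1 (w ε)) ∧
    TendstoLocallyUniformly w y (𝓝[>] 0) ∧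
    TendstoLocallyUniformly (fun ε => deriv (w ε)) (deriv y) (𝓝[>] 0)

end

/-! Write β = -α > 0. Everything rests on a rigidity fact: the equation y'' = s y + 2 y³ - β has
only one nonnegative solution on ℝ. Barriers on unit intervals (`le_of_second_deriv_ge_mul`,
`le_of_second_deriv_ge_cubic`, `le_sq_of_second_deriv_le`) force y ~ β/s at +∞ and y ~ √(|s|/2) at
-∞ from nonnegativity alone. Hence the quotient of two such solutions tends to 1 at both ends, and
the maximum principle excludes an interior maximum above 1 (`PainleveODE.le_of_subsolution`). The
same comparison applied to translates gives monotonicity, a Picone identity gives minimality, and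
Dirichlet solutions on (-N, N), obtained by shooting, converge to a solution as N → ∞.

For the convergence statements, a minimizer solves the Euler–Lagrange equation classically. Zooming
in at ξ turns it into the Painlevé equation with coefficient errors that vanish on bounded
intervals, and the profile is nonnegative there. The Keller–Osserman bound needs no boundary data,
so it gives local bounds without any energy estimate. Limits along ultrafilters therefore exist, are
nonnegative solutions (`ApproxPainleveODE.exists_limit`), and equal y by rigidity. The second
convergence statement reduces to the first through x ↦ -v(-x). -/

/-- `y` solves `y'' = s y + 2 y³ - β` on `ℝ`, with derivative `z`. -/
structure PainleveODE (β : ℝ) (y z : ℝ → ℝ) : Prop where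
  hasDerivAt : ∀ s, HasDerivAt y (z s) s
  hasDerivAt_deriv : ∀ s, HasDerivAt z (s * y s + 2 * y s ^ 3 - β) s

/-! ### Maximum principle and barriers on unit intervals -/

/-- If d were positive, the second derivative test would make c a local minimum too, so u would be
constant near c and d would vanish. -/
theorem IsLocalMax.second_deriv_nonpos {u u' : ℝ → ℝ} {c d : ℝ} (hmax : IsLocalMax u c)
    (h1 : ∀ᶠ t in 𝓝 c, HasDerivAt u (u' t) t) (h2 : HasDerivAt u' d c) : d ≤ 0 := by
  by_contra! hd
  have hu'c : u' c = 0 := hmax.hasDerivAt_eq_zero h1.self_of_nhds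
  have hder : deriv u =ᶠ[𝓝 c] u' := h1.mono fun t ht => ht.deriv
  have hdd : deriv (deriv u) c = d := by rw [hder.deriv_eq]; exact h2.deriv
  have hmin : IsLocalMin u c := by
    refine isLocalMin_of_deriv_deriv_pos (by rw [hdd]; exact hd) ?_ h1.self_of_nhds.continuousAt
    rw [hder.self_of_nhds, hu'c]
  have hconst : u =ᶠ[𝓝 c] fun _ => u c := by
    filter_upwards [hmin, hmax] with t ht1 ht2
    exact le_antisymm ht2 ht1
  have h0 : u' =ᶠ[𝓝 c] fun _ => 0 := by
    filter_upwards [hconst.eventually_nhds, h1] with t ht1 ht2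
    have := (hasDerivAt_const t (u c)).congr_of_eventuallyEq ht1
    exact ht2.unique this
  have := (hasDerivAt_const c (0 : ℝ)).congr_of_eventuallyEq h0
  have := h2.unique this
  linarith

theorem ContinuousOn.exists_isLocalMax_of_pos {F : ℝ → ℝ} {a b x₀ : ℝ}
    (hF : ContinuousOn F (Set.Icc a b)) (ha : F a ≤ 0) (hb : F b ≤ 0)
    (hx₀ : x₀ ∈ Set.Icc a b) (hpos : 0 < F x₀) :
    ∃ x ∈ Set.Ioo a b, F x₀ ≤ F x ∧ (∀ t ∈ Set.Icc a b, F t ≤ F x) := by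
  obtain ⟨x, hx, hmax⟩ := isCompact_Icc.exists_isMaxOn ⟨x₀, hx₀⟩ hF
  have h0 : F x₀ ≤ F x := hmax hx₀
  refine ⟨x, ⟨lt_of_le_of_ne hx.1 ?_, lt_of_le_of_ne hx.2 ?_⟩, h0, fun t ht => hmax ht⟩
  · rintro rfl; linarith
  · rintro rfl; linarith

theorem isLocalMax_of_forall_Icc {F : ℝ → ℝ} {a b x : ℝ} (hx : x ∈ Set.Ioo a b)
    (h : ∀ t ∈ Set.Icc a b, F t ≤ F x) : IsLocalMax F x :=
  (Icc_mem_nhds hx.1 hx.2 : Set.Icc a b ∈ 𝓝 x) |> fun hm => by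
    filter_upwards [hm] with t ht using h t ht

/-- Linear interior estimate: where `U'' ≥ k U`, an upper bound improves by a factor `2 / k`. -/
theorem le_of_second_deriv_ge_mul {U U' U'' : ℝ → ℝ} {c k M : ℝ} (hk : 0 < k) (hM : 0 ≤ M)
    (h1 : ∀ s ∈ Set.Icc (c - 1) (c + 1), HasDerivAt U (U' s) s)
    (h2 : ∀ s ∈ Set.Icc (c - 1) (c + 1), HasDerivAt U' (U'' s) s)
    (hU : ∀ s ∈ Set.Icc (c - 1) (c + 1), k * U s ≤ U'' s)
    (hb : ∀ s ∈ Set.Icc (c - 1) (c + 1), U s ≤ M) : U c ≤ 2 * M / k := by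
  by_contra! hlt
  -- The parabola has second derivative 2M and reaches M at both endpoints, so V is nonpositive
  -- there. At a positive interior maximum, U'' ≤ 2M while k U > 2M.
  set V : ℝ → ℝ := fun s => U s - M * (s - c) ^ 2 - 2 * M / k with hV
  have hMk : 0 ≤ 2 * M / k := by positivity
  have hd1 : ∀ s ∈ Set.Icc (c - 1) (c + 1), HasDerivAt V (U' s - 2 * M * (s - c)) s := by
    intro s hs
    have := ((h1 s hs).sub ((((hasDerivAt_id s).sub_const c).pow 2).const_mul M)).sub_const
      (2 * M / k)
    refine this.congr_deriv ?_
    simp; ring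
  have hcont : ContinuousOn V (Set.Icc (c - 1) (c + 1)) := fun s hs =>
    (hd1 s hs).continuousAt.continuousWithinAt
  have hmem : c ∈ Set.Icc (c - 1) (c + 1) := ⟨by linarith, by linarith⟩
  obtain ⟨x, hx, hVx, hmax⟩ := hcont.exists_isLocalMax_of_pos (x₀ := c)
    (by have := hb (c - 1) ⟨by linarith, by linarith⟩; simp only [hV]; nlinarith)
    (by have := hb (c + 1) ⟨by linarith, by linarith⟩; simp only [hV]; nlinarith)
    hmem (by simp only [hV]; nlinarith)
  have hIcc : Set.Icc (c - 1) (c + 1) ∈ 𝓝 x := Icc_mem_nhds hx.1 hx.2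
  have hd2 : HasDerivAt (fun s => U' s - 2 * M * (s - c)) (U'' x - 2 * M) x := by
    have := (h2 x ⟨hx.1.le, hx.2.le⟩).sub (((hasDerivAt_id x).sub_const c).const_mul (2 * M))
    refine this.congr_deriv ?_
    simp
  have hle := (isLocalMax_of_forall_Icc hx hmax).second_deriv_nonpos
    (by filter_upwards [hIcc] with t ht using hd1 t ht) hd2
  have hVc : 0 < V c := by simp only [hV]; nlinarith
  have hVx' : 0 < V x := hVc.trans_le hVx
  have hUx := hU x ⟨hx.1.le, hx.2.le⟩
  have : 2 * M / k < U x := by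
    simp only [hV] at hVx'; nlinarith [mul_nonneg hM (sq_nonneg (x - c))]
  rw [div_lt_iff₀ hk] at this
  nlinarith

/-- Keller–Osserman estimate. -/
theorem le_of_second_deriv_ge_cubic {w w' w'' : ℝ → ℝ} {c T b A : ℝ} (hA : 0 ≤ A)
    (hA1 : 0 ≤ 2 * A ^ 3 - T * A - b) (hA2 : T ≤ 6 * A ^ 2)
    (h1 : ∀ s ∈ Set.Icc (c - 1) (c + 1), HasDerivAt w (w' s) s)
    (h2 : ∀ s ∈ Set.Icc (c - 1) (c + 1), HasDerivAt w' (w'' s) s)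
    (hw : ∀ s ∈ Set.Icc (c - 1) (c + 1), 2 * w s ^ 3 - T * w s - b ≤ w'' s) :
    w c ≤ A + 2 := by
  by_contra! hlt
  -- With l = max Q, the function A + l / (1 - (s - c)²), which blows up at the endpoints, touches w
  -- from above at the maximum point.
  set Q : ℝ → ℝ := fun s => (w s - A) * (1 - (s - c) ^ 2) with hQ
  have hcont : ContinuousOn Q (Set.Icc (c - 1) (c + 1)) := by
    have : ContinuousOn w (Set.Icc (c - 1) (c + 1)) := fun s hs =>
      (h1 s hs).continuousAt.continuousWithinAt
    fun_prop
  have hmem : c ∈ Set.Icc (c - 1) (c + 1) := ⟨by linarith, by linarith⟩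
  obtain ⟨x, hx, hQx, hmax⟩ := hcont.exists_isLocalMax_of_pos (x₀ := c)
    (by simp [hQ]) (by simp [hQ]) hmem (by simp [hQ]; linarith)
  set l := Q x with hl
  have hl2 : 2 < l := by
    have : Q c = w c - A := by simp [hQ]
    linarith
  have hρ : ∀ s ∈ Set.Ioo (c - 1) (c + 1), 0 < 1 - (s - c) ^ 2 := by
    intro s hs; nlinarith [hs.1, hs.2]
  have hIoo : Set.Ioo (c - 1) (c + 1) ∈ 𝓝 x := Ioo_mem_nhds hx.1 hx.2
  set ρ := 1 - (x - c) ^ 2 with hρdef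
  have hρx : 0 < ρ := hρ x hx
  have hwx : w x = A + l / ρ := by
    have : l = (w x - A) * ρ := rfl
    rw [this]; field_simp; ring
  have hlocmax : IsLocalMax (fun s => w s - l / (1 - (s - c) ^ 2)) x := by
    filter_upwards [hIoo] with s hs
    have h := hmax s ⟨hs.1.le, hs.2.le⟩
    have hs' := hρ s hs
    have : w s - A ≤ l / (1 - (s - c) ^ 2) := by rw [le_div_iff₀ hs']; exact h
    have h2 : w x - l / (1 - (x - c) ^ 2) = A := by rw [hwx]; ring
    rw [h2]; linarith
  have hderρ : ∀ s, HasDerivAt (fun s => 1 - (s - c) ^ 2) (-(2 * (s - c))) s := by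
    intro s
    have := (((hasDerivAt_id s).sub_const c).pow 2).const_sub 1
    refine this.congr_deriv ?_; simp
  have hd1 : ∀ᶠ s in 𝓝 x, HasDerivAt (fun s => w s - l / (1 - (s - c) ^ 2))
      (w' s - l * (2 * (s - c)) / (1 - (s - c) ^ 2) ^ 2) s := by
    filter_upwards [hIoo] with s hs
    have := (h1 s ⟨hs.1.le, hs.2.le⟩).sub ((hasDerivAt_const s l).div (hderρ s) (hρ s hs).ne')
    refine this.congr_deriv ?_
    simp
  have hd2 : HasDerivAt (fun s => w' s - l * (2 * (s - c)) / (1 - (s - c) ^ 2) ^ 2)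
      (w'' x - l * (2 / ρ ^ 2 + 8 * (x - c) ^ 2 / ρ ^ 3)) x := by
    have hn : HasDerivAt (fun s => l * (2 * (s - c))) (l * 2) x := by
      have := (((hasDerivAt_id x).sub_const c).const_mul 2).const_mul l
      refine this.congr_deriv ?_; simp
    have := (h2 x ⟨hx.1.le, hx.2.le⟩).sub (hn.div ((hderρ x).pow 2) (pow_pos hρx 2).ne')
    refine this.congr_deriv ?_
    rw [show ((fun s => 1 - (s - c) ^ 2) ^ 2 : ℝ → ℝ) x = ρ ^ 2 from rfl, ← hρdef]
    push_cast
    field_simp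
    ring
  have hle := hlocmax.second_deriv_nonpos hd1 hd2
  have hwge := hw x ⟨hx.1.le, hx.2.le⟩
  rw [hwx] at hwge
  have e1 : l * (2 / ρ ^ 2 + 8 * (x - c) ^ 2 / ρ ^ 3) ≤ 8 * l / ρ ^ 3 := by
    rw [show l * (2 / ρ ^ 2 + 8 * (x - c) ^ 2 / ρ ^ 3) = l * (2 * ρ + 8 * (x - c) ^ 2) / ρ ^ 3 by
      field_simp]
    refine div_le_div_of_nonneg_right ?_ (by positivity)
    nlinarith [sq_nonneg (x - c)]
  set q := l / ρ with hq
  have hqpos : 0 < q := by positivity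
  -- This is 8 l < 2 l³, which is where the margin 2 in the conclusion comes from.
  have e2 : 8 * l / ρ ^ 3 < 2 * q ^ 3 := by
    rw [hq, div_pow, ← mul_div_assoc]
    refine div_lt_div_of_pos_right ?_ (by positivity)
    nlinarith [mul_pos (sub_pos.2 hl2) (by linarith : (0 : ℝ) < l)]
  have e3 : 2 * q ^ 3 ≤ 2 * (A + q) ^ 3 - T * (A + q) - b := by
    nlinarith [mul_nonneg hqpos.le (sub_nonneg.2 hA2), mul_nonneg hA (sq_nonneg q)]
  linarith

/-- A positive function with `y'' ≤ -(T - 2 y²) y` is not small. -/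
theorem le_sq_of_second_deriv_le {y y' y'' : ℝ → ℝ} {c T : ℝ}
    (h1 : ∀ s ∈ Set.Icc (c - 1) (c + 1), HasDerivAt y (y' s) s)
    (h2 : ∀ s ∈ Set.Icc (c - 1) (c + 1), HasDerivAt y' (y'' s) s)
    (hy : ∀ s ∈ Set.Icc (c - 1) (c + 1), y'' s ≤ -(T - 2 * y s ^ 2) * y s)
    (hpos : ∀ s ∈ Set.Icc (c - 1) (c + 1), 0 < y s) : T - 4 ≤ 2 * y c ^ 2 := by
  set Q : ℝ → ℝ := fun s => (1 - (s - c) ^ 2) ^ 2 / y s with hQ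
  have hcont : ContinuousOn Q (Set.Icc (c - 1) (c + 1)) := by
    have : ContinuousOn y (Set.Icc (c - 1) (c + 1)) := fun s hs =>
      (h1 s hs).continuousAt.continuousWithinAt
    exact ContinuousOn.div (by fun_prop) this fun s hs => (hpos s hs).ne'
  have hmem : c ∈ Set.Icc (c - 1) (c + 1) := ⟨by linarith, by linarith⟩
  have hQc : Q c = 1 / y c := by simp [hQ]
  have hyc := hpos c hmem
  obtain ⟨x, hx, hQx, hmax⟩ := hcont.exists_isLocalMax_of_pos (x₀ := c)
    (by simp [hQ]) (by simp [hQ]) hmem (by rw [hQc]; positivity)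
  set l := Q x with hl
  have hlc : 1 / y c ≤ l := hQc ▸ hQx
  have hlpos : 0 < l := lt_of_lt_of_le (by positivity) hlc
  have hIcc : Set.Icc (c - 1) (c + 1) ∈ 𝓝 x := Icc_mem_nhds hx.1 hx.2
  have hxI : x ∈ Set.Icc (c - 1) (c + 1) := ⟨hx.1.le, hx.2.le⟩
  have hyx := hpos x hxI
  have heq : (1 - (x - c) ^ 2) ^ 2 = l * y x := by
    have : l = (1 - (x - c) ^ 2) ^ 2 / y x := rfl
    rw [this]; field_simp
  have hlocmax : IsLocalMax (fun s => (1 - (s - c) ^ 2) ^ 2 - l * y s) x := by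
    filter_upwards [hIcc] with s hs
    have h := hmax s hs
    have h' : (1 - (s - c) ^ 2) ^ 2 ≤ l * y s := by
      rw [← div_le_iff₀ (hpos s hs)]; exact h
    linarith
  have hd1 : ∀ᶠ s in 𝓝 x, HasDerivAt (fun s => (1 - (s - c) ^ 2) ^ 2 - l * y s)
      (-4 * (s - c) + 4 * (s - c) ^ 3 - l * y' s) s := by
    filter_upwards [hIcc] with s hs
    have := (((((hasDerivAt_id s).sub_const c).pow 2).const_sub 1).pow 2).sub
      ((h1 s hs).const_mul l)
    refine this.congr_deriv ?_; simp; ring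
  have hd2 : HasDerivAt (fun s => -4 * (s - c) + 4 * (s - c) ^ 3 - l * y' s)
      (-4 + 12 * (x - c) ^ 2 - l * y'' x) x := by
    have := ((((hasDerivAt_id x).sub_const c).const_mul (-4)).add
      ((((hasDerivAt_id x).sub_const c).pow 3).const_mul 4)).sub ((h2 x hxI).const_mul l)
    refine this.congr_deriv ?_; simp; ring
  have hle := hlocmax.second_deriv_nonpos hd1 hd2
  have hyx'' := hy x hxI
  set e := (x - c) ^ 2 with he
  have he0 : 0 ≤ e := sq_nonneg _
  have h3 : -4 * (l * y x) ≤ -4 + 12 * e := by rw [← heq]; nlinarith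
  have h4 : -4 * (l * y x) ≤ l * (-(T - 2 * y x ^ 2) * y x) :=
    h3.trans (by nlinarith)
  have h5 : T - 4 ≤ 2 * y x ^ 2 := by
    have hp : 0 < l * y x := by positivity
    by_contra! hcon
    nlinarith
  have he1 : e ≤ 1 := by rw [he]; nlinarith [hx.1, hx.2]
  have h6 : l * y x ≤ 1 := by rw [← heq]; nlinarith
  have h7 : 1 ≤ l * y c := by rwa [div_le_iff₀ hyc] at hlc
  have h8 : y x ≤ y c := by
    by_contra! hcon
    nlinarith
  nlinarith

/-! ### Positivity and asymptotics of nonnegative solutions -/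

namespace PainleveODE

variable {β : ℝ} {y z : ℝ → ℝ}

theorem continuous (h : PainleveODE β y z) : Continuous y :=
  continuous_iff_continuousAt.2 fun s => (h.hasDerivAt s).continuousAt

theorem continuous_deriv (h : PainleveODE β y z) : Continuous z :=
  continuous_iff_continuousAt.2 fun s => (h.hasDerivAt_deriv s).continuousAt

theorem deriv_eq (h : PainleveODE β y z) : deriv y = z := funext fun s => (h.hasDerivAt s).deriv

/-- A zero would be a minimum, yet the equation gives y'' = -β < 0 there. -/
theorem pos_of_nonneg (h : PainleveODE β y z) (hβ : 0 < β) (hy : ∀ s, 0 ≤ y s) (s : ℝ) :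
    0 < y s := by
  refine lt_of_le_of_ne (hy s) fun h0 => ?_
  have hmax : IsLocalMax (fun t => -y t) s :=
    Eventually.of_forall fun t => by simpa [← h0] using hy t
  have := hmax.second_deriv_nonpos (Eventually.of_forall fun t => (h.hasDerivAt t).neg)
    (h.hasDerivAt_deriv s).neg
  rw [← h0] at this
  norm_num at this
  linarith

theorem le_of_one_le (h : PainleveODE β y z) (hβ : 0 < β) (hy : ∀ s, 0 ≤ y s) {s : ℝ}
    (hs : 1 ≤ s) : y s ≤ β + 3 := by
  have := le_of_second_deriv_ge_cubic (w := y) (c := s) (T := 0) (b := β) (A := 1 + β)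
    (by positivity) (by ring_nf; nlinarith [pow_pos hβ 3, pow_pos hβ 2]) (by positivity)
    (fun t _ => h.hasDerivAt t) (fun t _ => h.hasDerivAt_deriv t)
    (fun t ht => by nlinarith [mul_nonneg (by linarith [ht.1] : 0 ≤ t) (hy t)])
  linarith

/-- Subtracting β / (s - 1) absorbs the constant term, leaving U'' ≥ (s - 1) U for the linear
estimate. Each application gains a factor of order 1/s over the bound M, up to the β term. -/
theorem le_of_forall_Icc_le (h : PainleveODE β y z) (hy : ∀ s, 0 ≤ y s) (hβ : 0 < β)
    {s M : ℝ} (hs : 1 < s) (hM : ∀ t ∈ Set.Icc (s - 1) (s + 1), y t ≤ M) :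
    y s ≤ (β + 2 * M) / (s - 1) := by
  have hk : 0 < s - 1 := by linarith
  have hM0 : 0 ≤ M := (hy s).trans (hM s ⟨by linarith, by linarith⟩)
  have := le_of_second_deriv_ge_mul (U := fun t => y t - β / (s - 1)) (c := s) (M := M) hk hM0
    (fun t _ => (h.hasDerivAt t).sub_const _) (fun t _ => h.hasDerivAt_deriv t)
    (fun t ht => by
      have h1 : (s - 1) * (y t - β / (s - 1)) = (s - 1) * y t - β := by field_simp
      rw [h1]
      nlinarith [mul_nonneg (sub_nonneg.2 ht.1) (hy t), pow_nonneg (hy t) 3])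
    (fun t ht => (sub_le_self _ (by positivity)).trans (hM t ht))
  rw [add_div]; linarith

/-- Here k bounds the potential t + 2 y² from above on the window, so β / k - y falls under the
linear estimate. -/
theorem ge_of_forall_Icc_le (h : PainleveODE β y z) (hy : ∀ s, 0 ≤ y s) (hβ : 0 < β)
    {s M : ℝ} (hs : 1 < s) (hM : ∀ t ∈ Set.Icc (s - 1) (s + 1), y t ≤ M) :
    β / (s + 1 + 2 * M ^ 2) - 2 * (β / (s + 1 + 2 * M ^ 2)) / (s + 1 + 2 * M ^ 2) ≤ y s := by
  set k := s + 1 + 2 * M ^ 2 with hkdef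
  have hk : 0 < k := by positivity
  have := le_of_second_deriv_ge_mul (U := fun t => β / k - y t) (c := s) (M := β / k) hk
    (by positivity) (fun t _ => (h.hasDerivAt t).const_sub _)
    (fun t _ => (h.hasDerivAt_deriv t).neg)
    (fun t ht => by
      have h1 : k * (β / k - y t) = β - k * y t := by field_simp
      rw [h1, hkdef]
      have h2 : y t ^ 2 ≤ M ^ 2 := pow_le_pow_left₀ (hy t) (hM t ht) 2
      nlinarith [mul_nonneg (sub_nonneg.2 ht.2) (hy t), mul_nonneg (sub_nonneg.2 h2) (hy t)])
    (fun t ht => sub_le_self _ (hy t))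
  linarith

end PainleveODE

theorem tendsto_div_add_const_atTop (c : ℝ) :
    Tendsto (fun s : ℝ => s / (s + c)) atTop (𝓝 1) := by
  have h : Tendsto (fun s : ℝ => 1 - c * (s + c)⁻¹) atTop (𝓝 (1 - c * 0)) :=
    ((tendsto_inv_atTop_zero.comp (tendsto_atTop_add_const_right _ c tendsto_id)).const_mul
      c).const_sub 1
  simp only [mul_zero, sub_zero] at h
  refine h.congr' ?_
  filter_upwards [eventually_gt_atTop (-c)] with s hs
  have : s + c ≠ 0 := by linarith
  field_simp; ring

namespace PainleveODE

variable {β : ℝ} {y z : ℝ → ℝ}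

theorem tendsto_mul_atTop (h : PainleveODE β y z) (hβ : 0 < β) (hy : ∀ s, 0 ≤ y s) :
    Tendsto (fun s => s * y s) atTop (𝓝 β) := by
  -- Bootstrap: the constant bound β + 3 improves to C / (s - 1), and a second pass gives the sharp
  -- leading coefficient β.
  set C := β + 2 * (β + 3) with hC
  have hC0 : 0 < C := by positivity
  have h1 : ∀ s, 2 ≤ s → y s ≤ C / (s - 1) := fun s hs =>
    h.le_of_forall_Icc_le hy hβ (by linarith) fun t ht =>
      h.le_of_one_le hβ hy (by linarith [ht.1])
  have h2 : ∀ s, 3 ≤ s → y s ≤ (β + 2 * (C / (s - 2))) / (s - 1) := fun s hs =>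
    h.le_of_forall_Icc_le hy hβ (by linarith) fun t ht =>
      (h1 t (by linarith [ht.1])).trans
        (div_le_div_of_nonneg_left hC0.le (by linarith) (by linarith [ht.1]))
  set κ := 1 + 2 * (β + 3) ^ 2 with hκ
  have h3 : ∀ s, 2 ≤ s → β / (s + κ) - 2 * (β / (s + κ)) / (s + κ) ≤ y s := fun s hs => by
    have := h.ge_of_forall_Icc_le hy hβ (s := s) (by linarith) fun t ht =>
      h.le_of_one_le hβ hy (by linarith [ht.1])
    rwa [add_assoc] at this
  have hinv : ∀ c : ℝ, Tendsto (fun s : ℝ => (s + c)⁻¹) atTop (𝓝 0) := fun c =>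
    tendsto_inv_atTop_zero.comp (tendsto_atTop_add_const_right _ c tendsto_id)
  have hlow : Tendsto (fun s => s / (s + κ) * (β - 2 * β * (s + κ)⁻¹)) atTop (𝓝 β) := by
    simpa using (tendsto_div_add_const_atTop κ).mul (((hinv κ).const_mul (2 * β)).const_sub β)
  have hup : Tendsto (fun s => s / (s + (-1)) * (β + 2 * C * (s + (-2))⁻¹)) atTop (𝓝 β) := by
    simpa only [mul_zero, add_zero, one_mul] using (tendsto_div_add_const_atTop (-1)).mul
      (((hinv (-2)).const_mul (2 * C)).const_add β)
  refine tendsto_of_tendsto_of_tendsto_of_le_of_le' hlow hup ?_ ?_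
  · filter_upwards [eventually_ge_atTop 2] with s hs
    have hk : 0 < s + κ := by positivity
    calc s / (s + κ) * (β - 2 * β * (s + κ)⁻¹)
        = s * (β / (s + κ) - 2 * (β / (s + κ)) / (s + κ)) := by field_simp
      _ ≤ s * y s := by gcongr; exact h3 s hs
  · filter_upwards [eventually_ge_atTop 3] with s hs
    have hk : s - 1 ≠ 0 := by linarith
    have hk : s - 2 ≠ 0 := by linarith
    calc s * y s ≤ s * ((β + 2 * (C / (s - 2))) / (s - 1)) := by gcongr; exact h2 s hs
      _ = s / (s + (-1)) * (β + 2 * C * (s + (-2))⁻¹) := by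
        rw [← sub_eq_add_neg, ← sub_eq_add_neg]; field_simp

theorem tendsto_div_atBot (h : PainleveODE β y z) (hβ : 0 < β) (hy : ∀ s, 0 ≤ y s) :
    Tendsto (fun s => y s / √(|s| / 2)) atBot (𝓝 1) := by
  have hpos := h.pos_of_nonneg hβ hy
  -- On the window t ≤ s + 1, so T = -s - 1 works; the barrier lowers it by 4, whence -5.
  have hlow : ∀ s : ℝ, s ≤ -5 → √((-s + (-5)) / 2) ≤ y s := fun s hs => by
    have := le_sq_of_second_deriv_le (y := y) (c := s) (T := -s - 1)
      (fun t _ => h.hasDerivAt t) (fun t _ => h.hasDerivAt_deriv t)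
      (fun t ht => by nlinarith [mul_nonneg (sub_nonneg.2 ht.2) (hy t)]) (fun t _ => hpos t)
    rw [Real.sqrt_le_left (hy s)]
    linarith
  have hup : ∀ s : ℝ, s ≤ -5 → y s ≤ √((-s + 2) / 2) + (β + 2) := fun s hs => by
    set r := √((-s + 2) / 2) with hr
    have hr0 : 0 ≤ r := Real.sqrt_nonneg _
    have hr2 : r ^ 2 = (-s + 2) / 2 := Real.sq_sqrt (by linarith)
    -- The +2 in r makes 2 r² = T + 1. The unit of slack yields 2A³ - T A ≥ A ≥ β for A = r + β.
    have hT : -s + 1 ≤ 2 * (r + β) ^ 2 - 1 := by nlinarith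
    have := le_of_second_deriv_ge_cubic (w := y) (c := s) (T := -s + 1) (b := β) (A := r + β)
      (by positivity)
      (by nlinarith [mul_nonneg (add_nonneg hr0 hβ.le) (sub_nonneg.2 hT)])
      (by nlinarith [sq_nonneg (r + β)])
      (fun t _ => h.hasDerivAt t) (fun t _ => h.hasDerivAt_deriv t)
      (fun t ht => by nlinarith [mul_nonneg (sub_nonneg.2 ht.1) (hy t)])
    linarith
  have hratio : ∀ c : ℝ, Tendsto (fun s : ℝ => √((s + c) / 2) / √(s / 2)) atTop (𝓝 1) := by
    intro c
    have h1 : Tendsto (fun s : ℝ => 1 + c * s⁻¹) atTop (𝓝 (1 + c * 0)) :=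
      (tendsto_inv_atTop_zero.const_mul c).const_add 1
    have h2 := (Real.continuous_sqrt.tendsto _).comp h1
    simp only [mul_zero, add_zero, Real.sqrt_one] at h2
    refine h2.congr' ?_
    filter_upwards [eventually_gt_atTop 0, eventually_gt_atTop (-c)] with s hs hs'
    rw [Function.comp_apply, ← Real.sqrt_div (by linarith)]
    congr 1
    field_simp
  have hsq : Tendsto (fun s : ℝ => (β + 2) / √(s / 2)) atTop (𝓝 0) :=
    tendsto_const_nhds.div_atTop
      (Real.tendsto_sqrt_atTop.comp (tendsto_id.atTop_div_const (by norm_num)))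
  have key : Tendsto (fun s => y (-s) / √(s / 2)) atTop (𝓝 1) := by
    have hlim : Tendsto (fun s => √((s + 2) / 2) / √(s / 2) + (β + 2) / √(s / 2)) atTop (𝓝 1) := by
      simpa only [add_zero] using (hratio 2).add hsq
    refine tendsto_of_tendsto_of_tendsto_of_le_of_le' (hratio (-5)) hlim ?_ ?_
    · filter_upwards [eventually_ge_atTop 5] with s hs
      have := hlow (-s) (by linarith)
      rw [neg_neg] at this
      gcongr
    · filter_upwards [eventually_ge_atTop 5] with s hs
      have := hup (-s) (by linarith)
      rw [neg_neg] at this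
      rw [← add_div]
      exact div_le_div_of_nonneg_right this (Real.sqrt_nonneg _)
  refine (key.comp tendsto_neg_atBot_atTop).congr' ?_
  filter_upwards [eventually_le_atBot 0] with s hs
  simp [abs_of_nonpos hs]

theorem isEquivalent_atTop (h : PainleveODE β y z) (hβ : 0 < β) (hy : ∀ s, 0 ≤ y s) :
    y ~[atTop] fun s => β / s := by
  rw [isEquivalent_iff_tendsto_one]
  · have := (h.tendsto_mul_atTop hβ hy).div_const β
    rw [div_self hβ.ne'] at this
    refine this.congr fun s => ?_
    simp only [Pi.div_apply]
    rw [div_div_eq_mul_div, mul_comm]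
  · filter_upwards [eventually_gt_atTop 0] with s hs
    positivity

theorem isEquivalent_atBot (h : PainleveODE β y z) (hβ : 0 < β) (hy : ∀ s, 0 ≤ y s) :
    y ~[atBot] fun s => √(|s| / 2) := by
  rw [isEquivalent_iff_tendsto_one]
  · exact h.tendsto_div_atBot hβ hy
  · filter_upwards [eventually_lt_atBot 0] with s hs
    have : 0 < |s| := abs_pos.2 hs.ne
    positivity

/-! ### Comparison, uniqueness and monotonicity -/

/-- A positive subsolution that is asymptotically at most a positive solution lies below it. -/
theorem le_of_subsolution (h : PainleveODE β y z) (hβ : 0 < β) (hy : ∀ s, 0 < y s)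
    {u u' u'' : ℝ → ℝ} (hu1 : ∀ s, HasDerivAt u (u' s) s) (hu2 : ∀ s, HasDerivAt u' (u'' s) s)
    (hu : ∀ s, s * u s + 2 * u s ^ 3 - β ≤ u'' s)
    (htop : Tendsto (fun s => u s / y s) atTop (𝓝 1))
    (hbot : Tendsto (fun s => u s / y s) atBot (𝓝 1)) (s : ℝ) : u s ≤ y s := by
  by_contra! hs
  have hcont : Continuous fun s => u s / y s :=
    Continuous.div (continuous_iff_continuousAt.2 fun s => (hu1 s).continuousAt) h.continuous
      fun s => (hy s).ne'
  have hgt : 1 < u s / y s := (one_lt_div (hy s)).2 hs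
  -- The quotient exceeds at s its limit 1 at both ends, so it attains a global maximum.
  obtain ⟨x, hx⟩ := hcont.neg.exists_forall_le' (x₀ := s) (by
    rw [cocompact_eq_atBot_atTop, eventually_sup]
    exact ⟨(hbot.eventually_lt_const hgt).mono fun t ht => by simpa using ht.le,
      (htop.eventually_lt_const hgt).mono fun t ht => by simpa using ht.le⟩)
  replace hx : ∀ t, u t / y t ≤ u x / y x := fun t => neg_le_neg_iff.1 (hx t)
  set l := u x / y x with hl
  have hl1 : 1 < l := hgt.trans_le (hx s)
  have hux : u x = l * y x := by rw [hl]; field_simp [(hy x).ne']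
  have hmax : IsLocalMax (fun t => u t - l * y t) x := by
    refine Eventually.of_forall fun t => ?_
    have := hx t
    rw [div_le_iff₀ (hy t)] at this
    simp only [hux]; linarith
  have hle := hmax.second_deriv_nonpos
    (Eventually.of_forall fun t => (hu1 t).sub ((h.hasDerivAt t).const_mul l))
    ((hu2 x).sub ((h.hasDerivAt_deriv x).const_mul l))
  have hux' := hu x
  rw [hux] at hux'
  have hyx := pow_pos (hy x) 3
  -- Touching gives u'' ≤ l y'' at x, that is 2 (l³ - l) y³ + (l - 1) β ≤ 0, impossible for l > 1.
  have e : 0 < (l ^ 3 - l) * y x ^ 3 := by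
    have : 0 < l ^ 3 - l := by nlinarith [mul_pos (sub_pos.2 hl1) (by linarith : 0 < l)]
    positivity
  nlinarith [mul_pos (sub_pos.2 hl1) hβ]

theorem eq_of_nonneg (h : PainleveODE β y z) (hβ : 0 < β) (hy : ∀ s, 0 ≤ y s) {y₂ z₂ : ℝ → ℝ}
    (h₂ : PainleveODE β y₂ z₂) (hy₂ : ∀ s, 0 ≤ y₂ s) : y₂ = y := by
  have key : ∀ {y z y₂ z₂ : ℝ → ℝ}, PainleveODE β y z → (∀ s, 0 ≤ y s) →
      PainleveODE β y₂ z₂ → (∀ s, 0 ≤ y₂ s) → ∀ s, y₂ s ≤ y s := by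
    intro y z y₂ z₂ h hy h₂ hy₂
    have hp := h.pos_of_nonneg hβ hy
    refine h.le_of_subsolution hβ hp h₂.hasDerivAt h₂.hasDerivAt_deriv
      (fun s => le_rfl) ?_ ?_
    · exact (isEquivalent_iff_tendsto_one (Eventually.of_forall fun s => (hp s).ne')).1
        ((h₂.isEquivalent_atTop hβ hy₂).trans (h.isEquivalent_atTop hβ hy).symm)
    · exact (isEquivalent_iff_tendsto_one (Eventually.of_forall fun s => (hp s).ne')).1
        ((h₂.isEquivalent_atBot hβ hy₂).trans (h.isEquivalent_atBot hβ hy).symm)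
  exact funext fun s => le_antisymm (key h hy h₂ hy₂ s) (key h₂ hy₂ h hy s)

/-- For τ ≥ 0 the translate y(· + τ) is a subsolution, since (s + τ) y ≥ s y, and it has the same
asymptotics as y. -/
theorem antitone_of_nonneg (h : PainleveODE β y z) (hβ : 0 < β) (hy : ∀ s, 0 ≤ y s) :
    Antitone y := by
  have hp := h.pos_of_nonneg hβ hy
  suffices ∀ τ, 0 ≤ τ → ∀ s, y (s + τ) ≤ y s by
    intro s t hst
    simpa using this (t - s) (by linarith) s
  intro τ hτ
  refine h.le_of_subsolution hβ hp (fun s => (h.hasDerivAt (s + τ)).comp_add_const s τ)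
    (fun s => (h.hasDerivAt_deriv (s + τ)).comp_add_const s τ)
    (fun s => by nlinarith [mul_nonneg hτ (hy (s + τ))]) ?_ ?_
  · refine (isEquivalent_iff_tendsto_one (Eventually.of_forall fun s => (hp s).ne')).1
      (IsEquivalent.trans ?_ (h.isEquivalent_atTop hβ hy).symm)
    refine ((h.isEquivalent_atTop hβ hy).comp_tendsto
      (tendsto_atTop_add_const_right atTop τ tendsto_id)).trans ?_
    rw [isEquivalent_iff_tendsto_one]
    · refine (tendsto_div_add_const_atTop τ).congr' ?_
      filter_upwards [eventually_gt_atTop 0] with s hs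
      simp
      field_simp
    · filter_upwards [eventually_gt_atTop 0] with s hs
      positivity
  · refine (isEquivalent_iff_tendsto_one (Eventually.of_forall fun s => (hp s).ne')).1
      (IsEquivalent.trans ?_ (h.isEquivalent_atBot hβ hy).symm)
    refine ((h.isEquivalent_atBot hβ hy).comp_tendsto
      (tendsto_atBot_add_const_right atBot τ tendsto_id)).trans ?_
    rw [isEquivalent_iff_tendsto_one]
    · have h1 : Tendsto (fun s : ℝ => 1 + τ * s⁻¹) atBot (𝓝 (1 + τ * 0)) :=
        (tendsto_inv_atBot_zero.const_mul τ).const_add 1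
      have h2 := (Real.continuous_sqrt.tendsto _).comp h1
      simp only [mul_zero, add_zero, Real.sqrt_one] at h2
      refine h2.congr' ?_
      filter_upwards [eventually_lt_atBot 0, eventually_lt_atBot (-τ)] with s hs hs'
      simp only [Function.comp_apply, Pi.div_apply, id]
      rw [← Real.sqrt_div (by positivity), abs_of_neg hs, abs_of_neg (by linarith)]
      congr 1
      field_simp [hs.ne]
    · filter_upwards [eventually_lt_atBot 0] with s hs
      have : 0 < |s| := abs_pos.2 hs.ne
      positivity

/-- A zero of z ≤ 0 would be a maximum of z, but differentiating the equation gives z'' = y > 0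
there. -/
theorem deriv_neg_of_nonneg (h : PainleveODE β y z) (hβ : 0 < β) (hy : ∀ s, 0 ≤ y s) (s : ℝ) :
    z s < 0 := by
  have hle : ∀ t, z t ≤ 0 := fun t => by
    rw [← h.deriv_eq]; exact (h.antitone_of_nonneg hβ hy).deriv_nonpos
  refine lt_of_le_of_ne (hle s) fun h0 => ?_
  have hmax : IsLocalMax z s := Eventually.of_forall fun t => by rw [h0]; exact hle t
  have hd : HasDerivAt (fun t => t * y t + 2 * y t ^ 3 - β)
      (1 * y s + s * z s + 2 * (3 * y s ^ 2 * z s)) s := by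
    have := ((((hasDerivAt_id s).mul (h.hasDerivAt s)).add
      (((h.hasDerivAt s).pow 3).const_mul 2)).sub_const β)
    refine this.congr_deriv ?_
    simp
  have := hmax.second_deriv_nonpos (Eventually.of_forall h.hasDerivAt_deriv) hd
  rw [h0] at this
  linarith [h.pos_of_nonneg hβ hy s]

end PainleveODE

/-! ### Regularity and minimality -/

theorem contDiff_one_of_hasDerivAt {u u' : ℝ → ℝ} (h1 : ∀ s, HasDerivAt u (u' s) s)
    (hc : Continuous u') : ContDiff ℝ 1 u := by
  rw [contDiff_one_iff_deriv]
  exact ⟨fun s => (h1 s).differentiableAt, by rwa [funext fun s => (h1 s).deriv]⟩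

theorem contDiff_two_of_hasDerivAt {u u' u'' : ℝ → ℝ} (h1 : ∀ s, HasDerivAt u (u' s) s)
    (h2 : ∀ s, HasDerivAt u' (u'' s) s) (hc : Continuous u'') : ContDiff ℝ 2 u := by
  rw [show (2 : WithTop ℕ∞) = 1 + 1 by norm_num, contDiff_succ_iff_deriv]
  refine ⟨fun s => (h1 s).differentiableAt, by simp, ?_⟩
  rw [funext fun s => (h1 s).deriv]
  exact contDiff_one_of_hasDerivAt h2 hc

theorem IsPainleveIISolution.painleveODE {α : ℝ} {y : ℝ → ℝ} (h : IsPainleveIISolution α y) :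
    PainleveODE (-α) y (deriv y) := by
  have h1 : ContDiff ℝ 1 (deriv y) := by
    have := h.1
    rw [show (2 : WithTop ℕ∞) = 1 + 1 by norm_num, contDiff_succ_iff_deriv] at this
    exact this.2.2
  refine ⟨fun s => (h.1.differentiable (by norm_num) s).hasDerivAt, fun s => ?_⟩
  refine (h1.differentiable (by norm_num) s).hasDerivAt.congr_deriv ?_
  linarith [h.2 s]

namespace PainleveODE

variable {β : ℝ} {y z : ℝ → ℝ}

theorem isPainleveIISolution (h : PainleveODE β y z) : IsPainleveIISolution (-β) y := by
  have hc := h.continuous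
  refine ⟨contDiff_two_of_hasDerivAt h.hasDerivAt h.hasDerivAt_deriv (by fun_prop), fun s => ?_⟩
  rw [h.deriv_eq, (h.hasDerivAt_deriv s).deriv]
  ring

/-- Positive solutions are minimal, by the Picone identity. -/
theorem isMinimal (h : PainleveODE β y z) (hβ : 0 < β) (hy : ∀ s, 0 ≤ y s) :
    IsMinimalPainleveIISolution (-β) y := by
  refine ⟨h.isPainleveIISolution, fun φ hφ hφc => ?_⟩
  have hp := h.pos_of_nonneg hβ hy
  have hyc := h.continuous
  have hzc := h.continuous_deriv
  have hφ1 : ∀ s, HasDerivAt φ (deriv φ s) s := fun s =>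
    (hφ.differentiable (by simp) s).hasDerivAt
  have hφcont : Continuous φ := hφ.continuous
  have hφ'c : Continuous (deriv φ) := hφ.continuous_deriv (by simp)
  -- F' is the null Lagrangian to subtract: z φ accounts for the first variation and φ² z / (2y) is
  -- Picone's term. F has compact support, so F' integrates to zero.
  set F : ℝ → ℝ := fun s => z s * φ s + 1 / 2 * (φ s ^ 2 * (z s / y s)) with hF
  set F' : ℝ → ℝ := fun s => (s * y s + 2 * y s ^ 3 - β) * φ s + z s * deriv φ s
    + 1 / 2 * (2 * φ s * deriv φ s * (z s / y s) + φ s ^ 2 *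
      (((s * y s + 2 * y s ^ 3 - β) * y s - z s * z s) / y s ^ 2)) with hF'
  have hFF' : ∀ s, HasDerivAt F (F' s) s := fun s => by
    have := ((h.hasDerivAt_deriv s).mul (hφ1 s)).add ((((hφ1 s).pow 2).mul
      ((h.hasDerivAt_deriv s).div (h.hasDerivAt s) (hp s).ne')).const_mul (1 / 2))
    refine this.congr_deriv ?_
    simp [hF']
  have hyne : ∀ s, y s ≠ 0 := fun s => (hp s).ne'
  have hF'c : Continuous F' := by
    have : Continuous fun s => z s / y s := hzc.div hyc hyne
    have : Continuous fun s => ((s * y s + 2 * y s ^ 3 - β) * y s - z s * z s) / y s ^ 2 :=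
      Continuous.div (by fun_prop) (by fun_prop) fun s => pow_ne_zero 2 (hyne s)
    fun_prop
  have hφ0 : ∀ s, s ∉ tsupport φ → φ s = 0 := fun s hs => image_eq_zero_of_notMem_tsupport hs
  have hφ'0 : ∀ s, s ∉ tsupport φ → deriv φ s = 0 := fun s hs => by
    by_contra hne
    exact hs (support_deriv_subset hne)
  have hFint : Integrable F := by
    refine Continuous.integrable_of_hasCompactSupport
      (continuous_iff_continuousAt.2 fun s => (hFF' s).continuousAt)
      (HasCompactSupport.intro hφc fun s hs => ?_)
    simp [hF, hφ0 s hs]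
  have hF'0 : ∀ s, s ∉ tsupport φ → F' s = 0 := fun s hs => by
    simp [hF', hφ0 s hs, hφ'0 s hs]
  have hF'int : Integrable F' :=
    hF'c.integrable_of_hasCompactSupport (HasCompactSupport.intro hφc hF'0)
  have hzero : ∫ s in tsupport φ, F' s = 0 := by
    rw [setIntegral_eq_integral_of_forall_compl_eq_zero hF'0]
    exact integral_eq_zero_of_hasDerivAt_of_integrable hFF' hF'int hFint
  have hderiv : ∀ s, deriv (fun t => y t + φ t) s = z s + deriv φ s := fun s =>
    ((h.hasDerivAt s).add (hφ1 s)).deriv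
  have hcpt : IsCompact (tsupport φ) := hφc
  have hi1 : IntegrableOn (fun s => 1 / 2 * (deriv y s) ^ 2 + 1 / 2 * s * (y s) ^ 2
      + 1 / 2 * (y s) ^ 4 + -β * y s) (tsupport φ) := by
    rw [h.deriv_eq]
    exact (Continuous.continuousOn (by fun_prop)).integrableOn_compact hcpt
  have hi2 : IntegrableOn (fun s => 1 / 2 * (deriv (fun t => y t + φ t) s) ^ 2
      + 1 / 2 * s * (y s + φ s) ^ 2 + 1 / 2 * (y s + φ s) ^ 4 + -β * (y s + φ s))
      (tsupport φ) := by
    simp only [hderiv]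
    exact (Continuous.continuousOn (by fun_prop)).integrableOn_compact hcpt
  unfold painleveEnergy
  rw [← sub_nonneg, ← integral_sub hi2 hi1, ← hzero]
  refine setIntegral_mono hF'int.integrableOn (hi2.sub hi1) fun s => ?_
  simp only [hderiv, h.deriv_eq, hF']
  rw [← sub_nonneg]
  have hys := hp s
  -- What remains of the energy difference after removing F' is exactly this sum of nonnegative
  -- terms.
  have : 1 / 2 * (deriv φ s - φ s * (z s / y s)) ^ 2 + 1 / 2 * (β / y s * φ s ^ 2)
      + 1 / 2 * (φ s ^ 2 * (2 * y s + φ s) ^ 2) ≥ 0 := by positivity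
  refine this.trans_eq ?_
  field_simp
  ring

theorem isPositiveDecreasing (h : PainleveODE β y z) (hβ : 0 < β) (hy : ∀ s, 0 ≤ y s) :
    IsPositiveDecreasingPainleve (-β) y where
  minimal := h.isMinimal hβ hy
  pos := h.pos_of_nonneg hβ hy
  deriv_neg s := by rw [h.deriv_eq]; exact h.deriv_neg_of_nonneg hβ hy s
  asymp_atTop := by
    rw [abs_neg, abs_of_pos hβ]
    exact h.isEquivalent_atTop hβ hy
  asymp_atBot := h.isEquivalent_atBot hβ hy

end PainleveODE

/-! ### Compactness of approximate solutions -/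

/-- A family of nonnegative functions which, on every bounded interval, solve
`y'' = s y + 2 y³ - β` up to an error that is eventually small. -/
def ApproxPainleveODE {ι : Type*} (F : Filter ι) (β : ℝ) (w w₁ w₂ : ι → ℝ → ℝ) : Prop :=
  ∀ R δ : ℝ, 0 < δ → ∀ᶠ i in F, ∀ s, |s| ≤ R → 0 ≤ w i s ∧ HasDerivAt (w i) (w₁ i s) s ∧
    HasDerivAt (w₁ i) (w₂ i s) s ∧
    |w₂ i s - (s * w i s + 2 * w i s ^ 3 - β)| ≤ δ * (1 + w i s)

/-- Mean value inequality for f(r) - r L. Bounds in this form involve only values of f, so they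
survive pointwise limits. -/
theorem abs_sub_sub_mul_le {f f' : ℝ → ℝ} {s t L K : ℝ}
    (hf : ∀ r ∈ Set.uIcc s t, HasDerivAt f (f' r) r) (hK : ∀ r ∈ Set.uIcc s t, |f' r - L| ≤ K) :
    |f t - f s - (t - s) * L| ≤ K * |t - s| := by
  have := (convex_uIcc s t).norm_image_sub_le_of_norm_hasDerivWithin_le
    (f := fun r => f r - r * L) (f' := fun r => f' r - L) (C := K)
    (fun r hr => (((hf r hr).sub ((hasDerivAt_id r).mul_const L)).congr_deriv
      (by simp)).hasDerivWithinAt) hK Set.left_mem_uIcc Set.right_mem_uIcc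
  simp only [Real.norm_eq_abs] at this
  rwa [show f t - t * L - (f s - s * L) = f t - f s - (t - s) * L by ring] at this

theorem hasDerivAt_of_abs_le_sq {f : ℝ → ℝ} {s L C : ℝ}
    (h : ∀ t, |t - s| ≤ 1 → |f t - f s - (t - s) * L| ≤ C * |t - s| ^ 2) : HasDerivAt f L s := by
  rw [hasDerivAt_iff_isLittleO]
  have h1 : (fun t => f t - f s - (t - s) • L) =O[𝓝 s] fun t => |t - s| ^ 2 := by
    refine IsBigO.of_bound C ?_
    filter_upwards [Metric.closedBall_mem_nhds s one_pos] with t ht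
    simpa using h t (by simpa [Real.dist_eq] using ht)
  refine h1.trans_isLittleO ?_
  have h2 : (fun t => |t - s|) =o[𝓝 s] fun _ => (1 : ℝ) := by
    rw [isLittleO_one_iff]
    have : Tendsto (fun t => |t - s|) (𝓝 s) (𝓝 |s - s|) := by
      apply Continuous.tendsto; fun_prop
    simpa using this
  have h3 := h2.mul_isBigO (isBigO_refl (fun t => |t - s|) (𝓝 s))
  simp only [one_mul, ← sq] at h3
  exact h3.trans_isBigO (isBigO_of_le _ fun t => by simp)

theorem abs_le_of_mem_uIcc {s t r R : ℝ} (hs : |s| ≤ R) (ht : |t| ≤ R) (hr : r ∈ Set.uIcc s t) :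
    |r| ≤ R := by
  rw [abs_le] at *
  have := Set.uIcc_subset_Icc (a₂ := -R) (b₂ := R) hs ht hr
  exact this

theorem abs_sub_le_of_mem_uIcc {s t r : ℝ} (hr : r ∈ Set.uIcc s t) : |r - s| ≤ |t - s| := by
  exact Set.abs_sub_left_of_mem_uIcc hr

theorem tendstoLocallyUniformly_of_lipschitz {ι : Type*} {F : Filter ι} {f : ι → ℝ → ℝ}
    {g : ℝ → ℝ} (hg : Continuous g) (hfg : ∀ s, Tendsto (fun i => f i s) F (𝓝 (g s)))
    (hL : ∀ R : ℝ, ∃ M : ℝ, ∀ᶠ i in F, ∀ s t, |s| ≤ R → |t| ≤ R →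
      |f i t - f i s| ≤ M * |t - s|) :
    TendstoLocallyUniformly f g F := by
  rw [Metric.tendstoLocallyUniformly_iff]
  intro ε hε x
  obtain ⟨M, hM⟩ := hL (|x| + 1)
  have hcont : Tendsto (fun t => |g t - g x| + |M| * |t - x|) (𝓝 x) (𝓝 0) := by
    have : Tendsto (fun t => |g t - g x| + |M| * |t - x|) (𝓝 x)
        (𝓝 (|g x - g x| + |M| * |x - x|)) := by
      apply Continuous.tendsto; fun_prop
    simpa using this
  refine ⟨_, inter_mem (hcont.eventually_lt_const (half_pos hε))
    (Metric.closedBall_mem_nhds x one_pos), ?_⟩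
  filter_upwards [hM, (Metric.tendsto_nhds.1 (hfg x)) (ε / 2) (half_pos hε)] with i hi hix t ht
  have ht1 : |t - x| ≤ 1 := by simpa [Real.dist_eq] using ht.2
  have ht0 : |g t - g x| + |M| * |t - x| < ε / 2 := ht.1
  have h1 := hi x t (by linarith [abs_nonneg x]) (by
    have := abs_add_le x (t - x)
    rw [add_sub_cancel] at this; linarith)
  have h2 : M * |t - x| ≤ |M| * |t - x| := by gcongr; exact le_abs_self M
  rw [Real.dist_eq] at *
  have h3 : g t - f i t = (g t - g x) - (f i x - g x) - (f i t - f i x) := by ring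
  rw [h3]
  have h4 := abs_sub (g t - g x - (f i x - g x)) (f i t - f i x)
  have h5 := abs_sub (g t - g x) (f i x - g x)
  linarith

namespace ApproxPainleveODE

variable {ι : Type*} {F : Filter ι} {β : ℝ} {w w₁ w₂ : ι → ℝ → ℝ}

theorem mono (h : ApproxPainleveODE F β w w₁ w₂) {G : Filter ι} (hG : G ≤ F) :
    ApproxPainleveODE G β w w₁ w₂ := fun R δ hδ => hG (h R δ hδ)

/-- Keller–Osserman bounds w, the equation then bounds w₂, and a first-order Taylor expansion over a
step of length 1 bounds w₁. -/
theorem exists_bound (h : ApproxPainleveODE F β w w₁ w₂) (hβ : 0 < β) {R : ℝ} (hR : 0 ≤ R) :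
    ∃ M, 0 < M ∧ ∀ᶠ i in F, ∀ s, |s| ≤ R → w i s ≤ M ∧ |w₁ i s| ≤ M ∧ |w₂ i s| ≤ M := by
  -- On |t| ≤ R + 2 the error 1 + w (δ = 1) raises the linear coefficient to R + 3 and the constant
  -- to β + 1; A ≥ 1 dominates both.
  set A := (R + 3) + (β + 1) with hA
  set B := A + 2 with hB
  have hA1 : 1 ≤ A := by linarith
  set M₂ := (R + 1) * B + 2 * B ^ 3 + β + (1 + B) with hM₂
  have hB0 : 0 < B := by positivity
  have hM₂0 : 0 < M₂ := by positivity
  refine ⟨B + M₂, by positivity, ?_⟩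
  filter_upwards [h (R + 2) 1 one_pos] with i hi
  have hw : ∀ s, |s| ≤ R + 1 → w i s ≤ B := fun s hs => by
    have hmem : ∀ t ∈ Set.Icc (s - 1) (s + 1), |t| ≤ R + 2 := fun t ht => by
      rw [abs_le] at *
      exact ⟨by linarith [ht.1], by linarith [ht.2]⟩
    refine le_of_second_deriv_ge_cubic (T := R + 3) (b := β + 1) (by positivity) ?_ ?_
      (fun t ht => (hi t (hmem t ht)).2.1) (fun t ht => (hi t (hmem t ht)).2.2.1)
      (fun t ht => ?_)
    · have h1 : A ^ 2 ≤ A ^ 3 := pow_le_pow_right₀ hA1 (by norm_num)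
      nlinarith
    · nlinarith
    · obtain ⟨h0, -, -, h3⟩ := hi t (hmem t ht)
      have := (abs_le.1 h3).1
      have h4 := (abs_le.1 (hmem t ht)).1
      nlinarith [mul_nonneg (by linarith : 0 ≤ t + (R + 2)) h0]
  have hw₂ : ∀ s, |s| ≤ R + 1 → |w₂ i s| ≤ M₂ := fun s hs => by
    obtain ⟨h0, -, -, h3⟩ := hi s (by linarith)
    have hws := hw s hs
    have h5 : |s * w i s + 2 * w i s ^ 3 - β| ≤ (R + 1) * B + 2 * B ^ 3 + β := by
      refine (abs_sub _ _).trans (add_le_add ((abs_add_le _ _).trans (add_le_add ?_ ?_)) ?_)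
      · rw [abs_mul, abs_of_nonneg h0]; gcongr
      · rw [abs_of_nonneg (by positivity)]; gcongr
      · rw [abs_of_pos hβ]
    have h6 : w₂ i s = (w₂ i s - (s * w i s + 2 * w i s ^ 3 - β))
      + (s * w i s + 2 * w i s ^ 3 - β) := by ring
    rw [h6]
    refine (abs_add_le _ _).trans ?_
    linarith
  intro s hs
  have hs1 : |s| ≤ R + 1 := by linarith
  have hw0 := hw s hs1
  refine ⟨by linarith, ?_, by linarith [hw₂ s hs1]⟩
  have hmem : ∀ t ∈ Set.uIcc s (s + 1), |t| ≤ R + 1 := fun t ht =>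
    abs_le_of_mem_uIcc hs1 (by
      have := abs_add_le s 1; rw [abs_one] at this; linarith) ht
  have e1 := abs_sub_sub_mul_le (f := w i) (f' := w₁ i) (s := s) (t := s + 1) (L := w₁ i s)
    (K := M₂) (fun r hr => (hi r (by linarith [hmem r hr])).2.1) (fun r hr => by
      have hr' : ∀ q ∈ Set.uIcc s r, |q| ≤ R + 1 := fun q hq =>
        abs_le_of_mem_uIcc hs1 (hmem r hr) hq
      have := abs_sub_sub_mul_le (f := w₁ i) (f' := w₂ i) (s := s) (t := r) (L := 0)
        (K := M₂) (fun q hq => (hi q (by linarith [hr' q hq])).2.2.1)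
        (fun q hq => by simpa using hw₂ q (hr' q hq))
      have h8 := abs_sub_le_of_mem_uIcc hr
      simp only [add_sub_cancel_left, abs_one] at h8
      simp only [mul_zero, sub_zero] at this
      nlinarith)
  simp only [add_sub_cancel_left, abs_one, mul_one, one_mul] at e1
  have e2 := hw (s + 1) (hmem _ Set.right_mem_uIcc)
  have e3 := (hi s (by linarith)).1
  have e4 := (hi (s + 1) (by linarith [hmem _ (Set.right_mem_uIcc (a := s) (b := s + 1))])).1
  rw [abs_le] at *
  constructor <;> linarith [e1.1, e1.2]

theorem exists_lipschitz (h : ApproxPainleveODE F β w w₁ w₂) (hβ : 0 < β) {R : ℝ}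
    (hR : 0 ≤ R) : ∃ M, 0 < M ∧ ∀ᶠ i in F, (∀ s, |s| ≤ R → w i s ≤ M ∧ |w₁ i s| ≤ M) ∧
      ∀ s t, |s| ≤ R → |t| ≤ R →
      |w i t - w i s| ≤ M * |t - s| ∧ |w₁ i t - w₁ i s| ≤ M * |t - s| := by
  obtain ⟨M, hM, hb⟩ := h.exists_bound hβ hR
  refine ⟨M, hM, ?_⟩
  filter_upwards [hb, h R 1 one_pos] with i hi hi'
  refine ⟨fun s hs => ⟨(hi s hs).1, (hi s hs).2.1⟩, fun s t hs ht => ⟨?_, ?_⟩⟩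
  · simpa using abs_sub_sub_mul_le (f := w i) (f' := w₁ i) (s := s) (t := t) (L := 0) (K := M)
      (fun r hr => (hi' r (abs_le_of_mem_uIcc hs ht hr)).2.1)
      (fun r hr => by simpa using (hi r (abs_le_of_mem_uIcc hs ht hr)).2.1)
  · simpa using abs_sub_sub_mul_le (f := w₁ i) (f' := w₂ i) (s := s) (t := t) (L := 0) (K := M)
      (fun r hr => (hi' r (abs_le_of_mem_uIcc hs ht hr)).2.2.1)
      (fun r hr => by simpa using (hi r (abs_le_of_mem_uIcc hs ht hr)).2.2)

/-- Bounded real families converge along an ultrafilter, so pointwise limits exist without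
extracting subsequences. Uniform quadratic Taylor remainders then identify the derivatives of the
limits. -/
theorem exists_limit {U : Ultrafilter ι} (h : ApproxPainleveODE (U : Filter ι) β w w₁ w₂)
    (hβ : 0 < β) : ∃ W W₁ : ℝ → ℝ, PainleveODE β W W₁ ∧ (∀ s, 0 ≤ W s) ∧
      ∀ s, Tendsto (fun i => w i s) U (𝓝 (W s)) ∧ Tendsto (fun i => w₁ i s) U (𝓝 (W₁ s)) := by
  have hlim : ∀ (f : ι → ℝ) (M : ℝ), (∀ᶠ i in (U : Filter ι), |f i| ≤ M) →
      ∃ x, Tendsto f U (𝓝 x) := fun f M hf => by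
    obtain ⟨x, -, hx⟩ := (isCompact_Icc (a := -M) (b := M)).ultrafilter_le_nhds (U.map f)
      (by
        rw [le_principal_iff]
        exact hf.mono fun i hi => abs_le.1 hi)
    exact ⟨x, hx⟩
  have h1 : ∀ s, ∃ x, Tendsto (fun i => w i s) U (𝓝 x) := fun s => by
    obtain ⟨M, hM, hb⟩ := h.exists_bound hβ (abs_nonneg s)
    refine hlim _ M ?_
    filter_upwards [hb, h |s| 1 one_pos] with i hi hi'
    rw [abs_of_nonneg (hi' s le_rfl).1]
    exact (hi s le_rfl).1
  have h2 : ∀ s, ∃ x, Tendsto (fun i => w₁ i s) U (𝓝 x) := fun s => by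
    obtain ⟨M, hM, hb⟩ := h.exists_bound hβ (abs_nonneg s)
    exact hlim _ M (hb.mono fun i hi => (hi s le_rfl).2.1)
  choose W hW using h1
  choose W₁ hW₁ using h2
  refine ⟨W, W₁, ⟨fun s => ?_, fun s => ?_⟩, fun s => ?_, fun s => ⟨hW s, hW₁ s⟩⟩
  · obtain ⟨M, hM, hb⟩ := h.exists_lipschitz hβ (R := |s| + 1) (by positivity)
    refine hasDerivAt_of_abs_le_sq (C := M) fun t ht => ?_
    refine le_of_tendsto (((hW t).sub (hW s)).sub ((hW₁ s).const_mul (t - s))).abs ?_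
    have ht' : |t| ≤ |s| + 1 := by
      have := abs_add_le s (t - s); rw [add_sub_cancel] at this; linarith
    have hs' : |s| ≤ |s| + 1 := by linarith
    filter_upwards [hb, h (|s| + 1) 1 one_pos] with i hi hi'
    have := abs_sub_sub_mul_le (f := w i) (f' := w₁ i) (s := s) (t := t) (L := w₁ i s)
      (K := M * |t - s|) (fun r hr => (hi' r (abs_le_of_mem_uIcc hs' ht' hr)).2.1)
      (fun r hr => ((hi.2 s r hs' (abs_le_of_mem_uIcc hs' ht' hr)).2).trans
        (mul_le_mul_of_nonneg_left (abs_sub_le_of_mem_uIcc hr) hM.le))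
    linarith
  · set R := |s| + 1 with hR
    have hR0 : 0 ≤ R := by positivity
    obtain ⟨M, hM, hb⟩ := h.exists_lipschitz hβ (R := R) hR0
    -- The three terms of C bound the change in t w + 2 w³ from moving t, from w in the linear term,
    -- and from w in the cubic term. The equation error contributes at most η, which is arbitrary.
    refine hasDerivAt_of_abs_le_sq (C := M + R * M + 6 * M ^ 3) fun t ht => ?_
    refine le_of_forall_pos_le_add fun η hη => ?_
    refine le_of_tendsto (((hW₁ t).sub (hW₁ s)).sub (((((hW s).const_mul s).add
      (((hW s).pow 3).const_mul 2)).sub_const β).const_mul (t - s))).abs ?_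
    have ht' : |t| ≤ R := by
      have := abs_add_le s (t - s); rw [add_sub_cancel] at this; linarith
    have hs' : |s| ≤ R := by linarith
    filter_upwards [hb, h R (η / (1 + M)) (by positivity)] with i hi hi'
    have key := abs_sub_sub_mul_le (f := w₁ i) (f' := w₂ i) (s := s) (t := t)
      (L := s * w i s + 2 * w i s ^ 3 - β)
      (K := η + (M + R * M + 6 * M ^ 3) * |t - s|)
      (fun r hr => (hi' r (abs_le_of_mem_uIcc hs' ht' hr)).2.2.1)
      (fun r hr => by
        have hr' := abs_le_of_mem_uIcc hs' ht' hr
        have hd := abs_sub_le_of_mem_uIcc hr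
        obtain ⟨p0, -, -, p3⟩ := hi' r hr'
        have p4 := (hi.1 r hr').1
        have q0 := (hi' s hs').1
        have q4 := (hi.1 s hs').1
        have hl := (hi.2 s r hs' hr').1
        have e0 : η / (1 + M) * (1 + w i r) ≤ η := by
          rw [div_mul_eq_mul_div, div_le_iff₀ (by positivity)]
          gcongr
        have hl' : |w i r - w i s| ≤ M * |t - s| := hl.trans (by gcongr)
        have e1 : |(r - s) * w i r| ≤ M * |t - s| := by
          rw [abs_mul, abs_of_nonneg p0, mul_comm M]; gcongr
        have e2 : |s * (w i r - w i s)| ≤ R * M * |t - s| := by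
          rw [abs_mul, mul_assoc]; gcongr
        have e3 : |2 * (w i r ^ 2 + w i r * w i s + w i s ^ 2) * (w i r - w i s)|
            ≤ 6 * M ^ 3 * |t - s| := by
          rw [abs_mul, abs_of_nonneg (by positivity)]
          calc _ ≤ 2 * (M ^ 2 + M * M + M ^ 2) * (M * |t - s|) := by gcongr
            _ = _ := by ring
        have e4 : w₂ i r - (s * w i s + 2 * w i s ^ 3 - β) =
          (w₂ i r - (r * w i r + 2 * w i r ^ 3 - β)) + (r - s) * w i r + s * (w i r - w i s)
          + 2 * (w i r ^ 2 + w i r * w i s + w i s ^ 2) * (w i r - w i s) := by ring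
        rw [e4]
        refine (abs_add_le _ _).trans ?_
        refine (add_le_add_left ((abs_add_le _ _).trans
          (add_le_add_left (abs_add_le _ _) _)) _).trans ?_
        linarith)
    refine key.trans ?_
    nlinarith [abs_nonneg (t - s)]
  · refine ge_of_tendsto (hW s) ?_
    filter_upwards [h |s| 1 one_pos] with i hi using (hi s le_rfl).1

/-- Every ultrafilter finer than F has the same limit, by uniqueness of the nonnegative solution.
This gives pointwise convergence along F, and the Lipschitz bounds upgrade it. -/
theorem tendstoLocallyUniformly (h : ApproxPainleveODE F β w w₁ w₂) (hβ : 0 < β) {y z : ℝ → ℝ}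
    (hy : PainleveODE β y z) (hy0 : ∀ s, 0 ≤ y s) :
    TendstoLocallyUniformly w y F ∧ TendstoLocallyUniformly w₁ z F := by
  have hpt : ∀ s, Tendsto (fun i => w i s) F (𝓝 (y s)) ∧
      Tendsto (fun i => w₁ i s) F (𝓝 (z s)) := fun s => by
    simp only [tendsto_iff_ultrafilter (l₁ := F)]
    have key : ∀ U : Ultrafilter ι, (U : Filter ι) ≤ F → Tendsto (fun i => w i s) U (𝓝 (y s)) ∧
        Tendsto (fun i => w₁ i s) U (𝓝 (z s)) := fun U hU => by
      obtain ⟨W, W₁, hW, hW0, hlim⟩ := (h.mono hU).exists_limit hβ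
      have e1 : W = y := hy.eq_of_nonneg hβ hy0 hW hW0
      have e2 : W₁ = z := by rw [← hW.deriv_eq, ← hy.deriv_eq, e1]
      rw [← e1, ← e2]
      exact hlim s
    exact ⟨fun U hU => (key U hU).1, fun U hU => (key U hU).2⟩
  refine ⟨tendstoLocallyUniformly_of_lipschitz hy.continuous (fun s => (hpt s).1) fun R => ?_,
    tendstoLocallyUniformly_of_lipschitz hy.continuous_deriv (fun s => (hpt s).2) fun R => ?_⟩
  all_goals
    obtain ⟨M, -, hM⟩ := h.exists_lipschitz hβ (R := |R|) (abs_nonneg R)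
    refine ⟨M, hM.mono fun i hi s t hs ht => ?_⟩
    have := hi.2 s t (hs.trans (le_abs_self R)) (ht.trans (le_abs_self R))
    first | exact this.1 | exact this.2

end ApproxPainleveODE

/-! ### Existence of a nonnegative solution -/

/-- Shooting: a second-order equation with bounded Lipschitz right-hand side has a solution that
vanishes at both ends of a given interval. -/
theorem exists_dirichlet_solution {h : ℝ → ℝ → ℝ} {a b G : ℝ} {K : NNReal} (hab : a < b)
    (hlip : ∀ t ∈ Set.Icc a b, LipschitzWith K (h t))
    (hcont : ∀ x, ContinuousOn (fun t => h t x) (Set.Icc a b))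
    (hG : ∀ t ∈ Set.Icc a b, ∀ x, |h t x| ≤ G) :
    ∃ Y Z : ℝ → ℝ, Y a = 0 ∧ Y b = 0 ∧ ∀ t ∈ Set.Icc a b,
      HasDerivWithinAt Y (Z t) (Set.Icc a b) t ∧
      HasDerivWithinAt Z (h t (Y t)) (Set.Icc a b) t := by
  set T := b - a with hT
  have hT0 : 0 < T := by linarith
  have ha : a ∈ Set.Icc a b := ⟨le_rfl, hab.le⟩
  have hb : b ∈ Set.Icc a b := ⟨hab.le, le_rfl⟩
  have hG0 : 0 ≤ G := (abs_nonneg _).trans (hG a ha 0)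
  -- For initial slope q, Y(b) differs from q T by at most G T², so slopes ±Q give endpoint values
  -- of opposite (weak) signs.
  set Q := G * T with hQ
  have hQ0 : 0 ≤ Q := by positivity
  set M := Q + G * T with hM
  have hM0 : 0 ≤ M := by positivity
  -- Clamping the slope makes the field bounded, so Picard–Lindelöf covers the whole interval. The
  -- clamp is inactive, as |Z| ≤ Q + G T = M.
  set f : ℝ → ℝ × ℝ → ℝ × ℝ := fun t p => (max (-M) (min M p.2), h t p.1) with hf
  have hL0 : 0 ≤ max M G := le_max_of_le_left hM0
  have hPL : IsPicardLindelof f (tmin := a) (tmax := b) ⟨a, ha⟩ (0, 0)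
      ((max M G * T + Q).toNNReal) Q.toNNReal (max M G).toNNReal (max 1 (K * 1)) := by
    refine ⟨fun t ht => LipschitzWith.lipschitzOnWith ?_, fun x _ => ?_, fun t ht x _ => ?_, ?_⟩
    · exact ((LipschitzWith.prod_snd.const_min M).const_max (-M)).prodMk
        ((hlip t ht).comp LipschitzWith.prod_fst)
    · exact continuousOn_const.prodMk (hcont x.1)
    · rw [Real.coe_toNNReal _ hL0, Prod.norm_def]
      refine max_le_max ?_ (hG t ht _)
      rw [Real.norm_eq_abs, abs_le]
      exact ⟨le_max_left _ _, max_le (by linarith) (min_le_left _ _)⟩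
    · rw [Real.coe_toNNReal _ hL0, Real.coe_toNNReal _ hQ0, Real.coe_toNNReal _ (by positivity)]
      simp [hT0.le, ← hT]
  obtain ⟨α, hα, L', hL'⟩ :=
    hPL.exists_forall_mem_closedBall_eq_hasDerivWithinAt_lipschitzOnWith
  have hmem : ∀ q ∈ Set.Icc (-Q) Q, ((0 : ℝ), q) ∈ Metric.closedBall ((0 : ℝ), (0 : ℝ))
      Q.toNNReal := fun q hq => by
    rw [Real.coe_toNNReal _ hQ0, mem_closedBall_iff_norm]
    simp [Prod.norm_def, abs_le, hq.1, hq.2]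
  have hY : ∀ q ∈ Set.Icc (-Q) Q, ∀ t ∈ Set.Icc a b, HasDerivWithinAt (fun t => (α (0, q) t).1)
      (max (-M) (min M (α (0, q) t).2)) (Set.Icc a b) t := fun q hq t ht =>
    ((hα _ (hmem q hq)).2 t ht).fst
  have hZ : ∀ q ∈ Set.Icc (-Q) Q, ∀ t ∈ Set.Icc a b, HasDerivWithinAt (fun t => (α (0, q) t).2)
      (h t (α (0, q) t).1) (Set.Icc a b) t := fun q hq t ht =>
    ((hα _ (hmem q hq)).2 t ht).snd
  have hZq : ∀ q ∈ Set.Icc (-Q) Q, ∀ t ∈ Set.Icc a b, |(α (0, q) t).2 - q| ≤ G * T := by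
    intro q hq t ht
    have := (convex_Icc a b).norm_image_sub_le_of_norm_hasDerivWithin_le (hZ q hq)
      (fun x hx => hG x hx _) ha ht
    rw [(hα _ (hmem q hq)).1] at this
    refine this.trans (mul_le_mul_of_nonneg_left ?_ hG0)
    rw [Real.norm_eq_abs, abs_of_nonneg (sub_nonneg.2 ht.1)]
    linarith [ht.2]
  have hclamp : ∀ q ∈ Set.Icc (-Q) Q, ∀ t ∈ Set.Icc a b,
      max (-M) (min M (α (0, q) t).2) = (α (0, q) t).2 := fun q hq t ht => by
    have := abs_le.1 (hZq q hq t ht)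
    rw [min_eq_right (by linarith [hq.2]), max_eq_right (by linarith [hq.1])]
  have hend : ∀ q ∈ Set.Icc (-Q) Q, |(α (0, q) b).1 - q * T| ≤ G * T * T := by
    intro q hq
    have := (convex_Icc a b).norm_image_sub_le_of_norm_hasDerivWithin_le
      (f := fun t => (α (0, q) t).1 - t * q) (f' := fun t => (α (0, q) t).2 - q) (C := G * T)
      (fun t ht => ((hclamp q hq t ht ▸ hY q hq t ht).sub
        ((hasDerivWithinAt_id t _).mul_const q)).congr_deriv (by simp)) (hZq q hq) ha hb
    rw [(hα _ (hmem q hq)).1] at this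
    simp only [Real.norm_eq_abs] at this
    rw [abs_of_pos hT0] at this
    rwa [show (α (0, q) b).1 - b * q - (0 - a * q) = (α (0, q) b).1 - q * T by
      rw [hT]; ring] at this
  have hcQ : ContinuousOn (fun q => (α (0, q) b).1) (Set.Icc (-Q) Q) :=
    continuous_fst.comp_continuousOn ((hL' b hb).continuousOn.comp (by fun_prop) hmem)
  obtain ⟨q, hq, hq0⟩ := intermediate_value_Icc (by linarith : -Q ≤ Q) hcQ
    (show (0 : ℝ) ∈ _ from ⟨by
      have := (abs_le.1 (hend (-Q) ⟨le_rfl, by linarith⟩)).2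
      nlinarith, by
      have := (abs_le.1 (hend Q ⟨by linarith, le_rfl⟩)).1
      nlinarith⟩)
  refine ⟨fun t => (α (0, q) t).1, fun t => (α (0, q) t).2, ?_, hq0, fun t ht =>
    ⟨(hY q hq t ht).congr_deriv (hclamp q hq t ht), hZ q hq t ht⟩⟩
  exact congrArg Prod.fst (hα _ (hmem q hq)).1

theorem exists_nonneg_solution_Ioo {β N : ℝ} (hβ : 0 < β) (hN : 0 < N) :
    ∃ Y Z : ℝ → ℝ, ∀ s ∈ Set.Ioo (-N) N, 0 ≤ Y s ∧ HasDerivAt Y (Z s) s ∧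
      HasDerivAt Z (s * Y s + 2 * Y s ^ 3 - β) s := by
  -- Large enough that t p + 2 p³ - β > 0 for t > -N, so no interior maximum reaches above p. At a
  -- negative minimum the truncated equation reads Y'' = -β. Hence the truncation to [0, p] is
  -- inactive.
  set p := 1 + N + β with hp
  have hp0 : 0 < p := by positivity
  set c : ℝ → ℝ := fun x => max 0 (min p x) with hc
  have hc0 : ∀ x, 0 ≤ c x := fun x => le_max_left _ _
  have hcp : ∀ x, c x ≤ p := fun x => max_le hp0.le (min_le_left _ _)
  have hclip : ∀ x x', |c x - c x'| ≤ |x - x'| := fun x x' => by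
    have := ((LipschitzWith.id.const_min p).const_max 0).dist_le_mul x x'
    simpa [Real.dist_eq] using this
  set h : ℝ → ℝ → ℝ := fun t x => t * c x + 2 * c x ^ 3 - β with hh
  have hlip : ∀ t ∈ Set.Icc (-N) N, LipschitzWith (N + 6 * p ^ 2).toNNReal (h t) := by
    intro t ht
    refine LipschitzWith.of_dist_le_mul fun x x' => ?_
    rw [Real.coe_toNNReal _ (by positivity), Real.dist_eq, Real.dist_eq]
    have e : h t x - h t x' = (t + 2 * (c x ^ 2 + c x * c x' + c x' ^ 2)) * (c x - c x') := by
      simp only [hh]; ring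
    rw [e, abs_mul]
    refine mul_le_mul ?_ (hclip x x') (abs_nonneg _) (by positivity)
    have h1 := hc0 x
    have h2 := hc0 x'
    refine (abs_add_le _ _).trans (add_le_add (abs_le.2 ht) ?_)
    rw [abs_of_nonneg (by positivity)]
    calc _ ≤ 2 * (p ^ 2 + p * p + p ^ 2) := by
          have h3 := hcp x
          have h4 := hcp x'
          gcongr
      _ = _ := by ring
  have hG : ∀ t ∈ Set.Icc (-N) N, ∀ x, |h t x| ≤ N * p + 2 * p ^ 3 + β := by
    intro t ht x
    have h1 := hc0 x
    refine (abs_sub _ _).trans (add_le_add ((abs_add_le _ _).trans (add_le_add ?_ ?_)) ?_)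
    · rw [abs_mul, abs_of_nonneg h1]
      exact mul_le_mul (abs_le.2 ht) (hcp x) h1 hN.le
    · rw [abs_of_nonneg (by positivity)]
      have h3 := hcp x
      gcongr
    · rw [abs_of_pos hβ]
  obtain ⟨Y, Z, hYa, hYb, hYZ⟩ := exists_dirichlet_solution (by linarith : -N < N) hlip
    (fun x => by fun_prop) hG
  have hd : ∀ s ∈ Set.Ioo (-N) N, HasDerivAt Y (Z s) s ∧ HasDerivAt Z (h s (Y s)) s :=
    fun s hs => ⟨(hYZ s ⟨hs.1.le, hs.2.le⟩).1.hasDerivAt (Icc_mem_nhds hs.1 hs.2),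
      (hYZ s ⟨hs.1.le, hs.2.le⟩).2.hasDerivAt (Icc_mem_nhds hs.1 hs.2)⟩
  have hYc : ContinuousOn Y (Set.Icc (-N) N) := fun s hs => (hYZ s hs).1.continuousWithinAt
  have hY0 : ∀ s ∈ Set.Icc (-N) N, 0 ≤ Y s := by
    intro s hs
    by_contra! hneg
    obtain ⟨x, hx, hle, hmax⟩ := hYc.neg.exists_isLocalMax_of_pos (by simp [hYa])
      (by simp [hYb]) hs (by simpa using hneg)
    have := (isLocalMax_of_forall_Icc hx hmax).second_deriv_nonpos
      (by filter_upwards [Ioo_mem_nhds hx.1 hx.2] with t ht using (hd t ht).1.neg)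
      (hd x hx).2.neg
    have hYx : Y x ≤ 0 := by simp only [Pi.neg_apply] at hle; linarith
    have hcx : c (Y x) = 0 := by simp [hc, hYx]
    simp only [hh, hcx] at this
    norm_num at this
    linarith
  have hYp : ∀ s ∈ Set.Icc (-N) N, Y s ≤ p := by
    intro s hs
    by_contra! hgt
    obtain ⟨x, hx, hle, hmax⟩ := (hYc.sub continuousOn_const).exists_isLocalMax_of_pos
      (F := fun s => Y s - p) (by simp [hYa, hp0.le]) (by simp [hYb, hp0.le]) hs
      (by simpa using hgt)
    have := (isLocalMax_of_forall_Icc hx hmax).second_deriv_nonpos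
      (by filter_upwards [Ioo_mem_nhds hx.1 hx.2] with t ht using (hd t ht).1.sub_const p)
      (hd x hx).2
    have hYx : p ≤ Y x := by linarith
    have hcx : c (Y x) = p := by simp [hc, hYx, hp0.le]
    simp only [hh, hcx] at this
    nlinarith [mul_pos hp0 (by linarith [hx.1] : 0 < x + N), mul_pos hp0 hN, mul_pos hp0 hβ,
      mul_pos hp0 hp0, mul_pos (mul_pos hp0 hp0) hN, mul_pos (mul_pos hp0 hp0) hβ]
  refine ⟨Y, Z, fun s hs => ?_⟩
  have hs' : s ∈ Set.Icc (-N) N := ⟨hs.1.le, hs.2.le⟩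
  refine ⟨hY0 s hs', (hd s hs).1, (hd s hs).2.congr_deriv ?_⟩
  simp [hh, hc, hY0 s hs', hYp s hs']

/-- The solutions on (-(n+1), n+1) form an approximate family with zero error, and the compactness
theorem supplies a limit. -/
theorem exists_nonneg_painleveODE {β : ℝ} (hβ : 0 < β) :
    ∃ y z : ℝ → ℝ, PainleveODE β y z ∧ ∀ s, 0 ≤ y s := by
  choose Y Z hYZ using fun n : ℕ => exists_nonneg_solution_Ioo hβ (Nat.cast_add_one_pos n)
  have happ : ApproxPainleveODE atTop β Y Z fun n s => s * Y n s + 2 * Y n s ^ 3 - β := by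
    intro R δ hδ
    filter_upwards [tendsto_natCast_atTop_atTop.eventually_gt_atTop R] with n hn s hs
    have hs' := abs_le.1 hs
    obtain ⟨h0, h1, h2⟩ := hYZ n s ⟨by linarith, by linarith⟩
    exact ⟨h0, h1, h2, by rw [sub_self, abs_zero]; positivity⟩
  obtain ⟨y, z, hyz, hy, -⟩ :=
    (happ.mono (Nat.hyperfilter_le_atTop)).exists_limit hβ
  exact ⟨y, z, hyz, hy⟩

/-! ### Weak derivatives and H¹ functions -/

theorem HasCompactSupport.exists_forall_abs_ge {φ : ℝ → ℝ} (hφ : HasCompactSupport φ) :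
    ∃ R, 0 < R ∧ ∀ x, R ≤ |x| → φ x = 0 := by
  obtain ⟨R, hR, hsub⟩ := hφ.isCompact.isBounded.subset_ball_lt 0 0
  refine ⟨R, hR, fun x hx => image_eq_zero_of_notMem_tsupport fun hmem => ?_⟩
  have := hsub hmem
  rw [Metric.mem_ball, Real.dist_eq, sub_zero] at this
  linarith

theorem deriv_eq_zero_of_forall_abs_ge {φ : ℝ → ℝ} {R : ℝ} (h : ∀ x, R ≤ |x| → φ x = 0) {x : ℝ}
    (hx : R < |x|) : deriv φ x = 0 := by
  have : φ =ᶠ[𝓝 x] fun _ => 0 := by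
    filter_upwards [continuous_abs.continuousAt.eventually_const_lt hx] with t ht using h t ht.le
  rw [this.deriv_eq, deriv_const]

theorem integral_eq_intervalIntegral_of_forall_abs_ge {f : ℝ → ℝ} {R : ℝ}
    (h : ∀ x, R < |x| → f x = 0) {S : ℝ} (hS : R < S) : ∫ x in (-S)..S, f x = ∫ x, f x := by
  refine intervalIntegral.integral_eq_integral_of_support_subset fun x hx => ?_
  have h1 : |x| ≤ R := by
    by_contra! hlt
    exact hx (h x hlt)
  rw [abs_le] at h1
  exact ⟨by linarith, by linarith⟩

theorem MeasureTheory.LocallyIntegrable.intervalIntegrable_real {k : ℝ → ℝ}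
    (hk : LocallyIntegrable k) (a b : ℝ) : IntervalIntegrable k volume a b :=
  (hk.integrableOn_isCompact isCompact_uIcc).intervalIntegrable

/-- A locally integrable function with vanishing weak derivative is constant. -/
theorem exists_ae_eq_const_of_integral_mul_deriv_eq_zero {H : ℝ → ℝ} (hH : LocallyIntegrable H)
    (h : ∀ φ : ℝ → ℝ, ContDiff ℝ ∞ φ → HasCompactSupport φ → ∫ x, H x * deriv φ x = 0) :
    ∃ c : ℝ, H =ᵐ[volume] fun _ => c := by
  set b : ContDiffBump (0 : ℝ) := default
  set ρ := b.normed volume with hρ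
  have hρ1 : ∫ x, ρ x = 1 := b.integral_normed
  have hρs : ContDiff ℝ ∞ ρ := b.contDiff_normed
  have hρc : HasCompactSupport ρ := b.hasCompactSupport_normed
  refine ⟨∫ x, ρ x * H x, ae_eq_of_integral_contDiff_smul_eq hH
    (locallyIntegrable_const _) fun ψ hψs hψc => ?_⟩
  simp only [smul_eq_mul]
  rw [integral_mul_const]
  set m := ∫ x, ψ x with hm
  -- Subtracting m times the unit-mass bump gives mean zero, so the primitive of ψ₀ has compact
  -- support and is a test function.
  set ψ₀ : ℝ → ℝ := fun x => ψ x - m * ρ x with hψ₀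
  have hψ₀s : ContDiff ℝ ∞ ψ₀ := hψs.sub (contDiff_const.mul hρs)
  have hψi : Integrable ψ := hψs.continuous.integrable_of_hasCompactSupport hψc
  have hρi : Integrable ρ := hρs.continuous.integrable_of_hasCompactSupport hρc
  have hψ₀i : ∫ x, ψ₀ x = 0 := by
    rw [integral_sub hψi (hρi.const_mul m), integral_const_mul, hρ1]
    simp [hm]
  obtain ⟨R₁, hR₁, h1⟩ := hψc.exists_forall_abs_ge
  obtain ⟨R₂, hR₂, h2⟩ := hρc.exists_forall_abs_ge
  set R := max R₁ R₂ with hR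
  have hR0 : 0 < R := lt_max_of_lt_left hR₁
  have h0 : ∀ x, R ≤ |x| → ψ₀ x = 0 := fun x hx => by
    simp [hψ₀, h1 x ((le_max_left _ _).trans hx), h2 x ((le_max_right _ _).trans hx)]
  set φ : ℝ → ℝ := fun x => ∫ t in (-(R + 1))..x, ψ₀ t with hφ
  have hφd : ∀ x, HasDerivAt φ (ψ₀ x) x := fun x =>
    intervalIntegral.integral_hasDerivAt_right (hψ₀s.continuous.intervalIntegrable _ _)
      (hψ₀s.continuous.stronglyMeasurableAtFilter _ _) hψ₀s.continuous.continuousAt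
  have hφ' : deriv φ = ψ₀ := funext fun x => (hφd x).deriv
  have hφs : ContDiff ℝ ∞ φ := by
    rw [contDiff_infty_iff_deriv, hφ']
    exact ⟨fun x => (hφd x).differentiableAt, hψ₀s⟩
  have hzero : ∀ p q : ℝ, (∀ x ∈ Set.uIcc p q, R ≤ |x|) → ∫ t in p..q, ψ₀ t = 0 := by
    intro p q hpq
    rw [intervalIntegral.integral_congr (g := fun _ => 0) fun x hx => h0 x (hpq x hx)]
    simp
  have hφc : HasCompactSupport φ := by
    refine HasCompactSupport.intro (isCompact_Icc (a := -(R + 1)) (b := R + 1)) fun x hx => ?_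
    rw [Set.mem_Icc, not_and_or, not_le, not_le] at hx
    rcases hx with hx | hx
    · refine hzero _ _ fun t ht => ?_
      rw [Set.uIcc_of_ge hx.le] at ht
      rw [abs_of_neg (by linarith [ht.2])]
      linarith [ht.2]
    · have hsplit := intervalIntegral.integral_add_adjacent_intervals
        (hψ₀s.continuous.intervalIntegrable (μ := volume) (-(R + 1)) (R + 1))
        (hψ₀s.continuous.intervalIntegrable (μ := volume) (R + 1) x)
      simp only [hφ]
      rw [← hsplit, integral_eq_intervalIntegral_of_forall_abs_ge (R := R)
        (fun t ht => h0 t ht.le) (by linarith), hψ₀i, zero_add]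
      refine hzero _ _ fun t ht => ?_
      rw [Set.uIcc_of_le hx.le] at ht
      rw [abs_of_pos (by linarith [ht.1])]
      linarith [ht.1]
  have key := h φ hφs hφc
  rw [hφ'] at key
  have i1 : Integrable fun x => ψ x * H x :=
    hH.integrable_smul_left_of_hasCompactSupport hψs.continuous hψc
  have i2 : Integrable fun x => ρ x * H x :=
    hH.integrable_smul_left_of_hasCompactSupport hρs.continuous hρc
  have e : (fun x => H x * ψ₀ x) = fun x => ψ x * H x - m * (ρ x * H x) := by
    funext x; simp only [hψ₀]; ring
  rw [e, integral_sub i1 (i2.const_mul m), integral_const_mul] at key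
  linarith

theorem MeasureTheory.LocallyIntegrable.continuous_primitive_real {k : ℝ → ℝ}
    (hk : LocallyIntegrable k) : Continuous fun x => ∫ t in (0 : ℝ)..x, k t :=
  intervalIntegral.continuous_primitive hk.intervalIntegrable_real 0

/-- Integration by parts of a primitive against a test function. -/
theorem integral_primitive_mul_deriv {k φ : ℝ → ℝ} (hk : LocallyIntegrable k)
    (hφ : ContDiff ℝ ∞ φ) (hφc : HasCompactSupport φ) :
    ∫ x, (∫ t in (0 : ℝ)..x, k t) * deriv φ x = -∫ x, k x * φ x := by
  obtain ⟨R, hR, h0⟩ := hφc.exists_forall_abs_ge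
  rw [← integral_eq_intervalIntegral_of_forall_abs_ge (R := R) (S := R + 1)
      (fun x hx => by rw [deriv_eq_zero_of_forall_abs_ge h0 hx, mul_zero]) (by linarith),
    ← integral_eq_intervalIntegral_of_forall_abs_ge (R := R) (S := R + 1)
      (fun x hx => by rw [h0 x hx.le, mul_zero]) (by linarith)]
  have hac : AbsolutelyContinuousOnInterval (fun x => ∫ t in (0 : ℝ)..x, k t) (-(R + 1)) (R + 1) :=
    (hk.intervalIntegrable_real _ _).absolutelyContinuousOnInterval_intervalIntegral
      (Set.mem_uIcc_of_le (by linarith) (by linarith))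
  have hφac : AbsolutelyContinuousOnInterval φ (-(R + 1)) (R + 1) :=
    ContDiffOn.absolutelyContinuousOnInterval (hφ.of_le (by simp)).contDiffOn
  rw [hac.integral_mul_deriv_eq_deriv_mul hφac, h0 (R + 1) (by rw [abs_of_pos] <;> linarith),
    h0 (-(R + 1)) (by rw [abs_neg, abs_of_pos] <;> linarith)]
  simp only [mul_zero, sub_zero, zero_sub]
  congr 1
  refine intervalIntegral.integral_congr_ae ?_
  filter_upwards [_root_.LocallyIntegrable.ae_hasDerivAt_integral hk] with x hx _
  rw [(hx 0).deriv]

/-- A continuous function with locally integrable weak derivative is its primitive. -/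
theorem eq_add_primitive_of_weak_deriv {u g : ℝ → ℝ} (hu : Continuous u)
    (hg : LocallyIntegrable g)
    (h : ∀ φ : ℝ → ℝ, ContDiff ℝ ∞ φ → HasCompactSupport φ →
      ∫ x, u x * deriv φ x = -∫ x, g x * φ x) (x : ℝ) :
    u x = u 0 + ∫ t in (0 : ℝ)..x, g t := by
  have hc := hg.continuous_primitive_real
  obtain ⟨c, hcc⟩ := exists_ae_eq_const_of_integral_mul_deriv_eq_zero
    (hu.sub hc).locallyIntegrable fun φ hφ hφc => by
      have hd : Continuous (deriv φ) := hφ.continuous_deriv (by simp)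
      simp only [Pi.sub_apply, sub_mul]
      rw [integral_sub, h φ hφ hφc, integral_primitive_mul_deriv hg hφ hφc, sub_self]
      · exact (hu.mul hd).integrable_of_hasCompactSupport hφc.deriv.mul_left
      · exact (hc.mul hd).integrable_of_hasCompactSupport hφc.deriv.mul_left
  have heq := (Continuous.ae_eq_iff_eq volume (hu.sub hc) continuous_const).1 hcc
  have h1 := congrFun heq x
  have h2 := congrFun heq 0
  simp only [Pi.sub_apply, intervalIntegral.integral_same, sub_zero] at h1 h2
  linarith

/-- On [x, x + 1] some value satisfies u(z)² ≤ ∫ u², and |u(z) - u(x)| ≤ ∫ (1 + g²) over the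
interval. Boundedness makes the quartic term of the energy integrable. -/
theorem IsH1WithWeakDeriv.exists_bound {u g : ℝ → ℝ} (h : IsH1WithWeakDeriv u g)
    (hu : Continuous u) : ∃ C, ∀ x, |u x| ≤ C := by
  have hg : LocallyIntegrable g := h.memLp_deriv.locallyIntegrable (by norm_num)
  have hrep := eq_add_primitive_of_weak_deriv hu hg h.weak_deriv
  have hu2 := h.memLp.integrable_sq
  have hg2 := h.memLp_deriv.integrable_sq
  set I := ∫ x, u x ^ 2 with hI
  set J := ∫ x, g x ^ 2 with hJ
  have hJ0 : 0 ≤ J := integral_nonneg fun x => sq_nonneg _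
  refine ⟨(1 + I) + (1 + J), fun x => ?_⟩
  obtain ⟨z, hz, hmin⟩ := (isCompact_Icc (a := x) (b := x + 1)).exists_isMinOn
    ⟨x, by simp⟩ (hu.pow 2).continuousOn
  have hzI : u z ^ 2 ≤ I := by
    calc u z ^ 2 = ∫ _ in x..(x + 1), u z ^ 2 := by simp
      _ ≤ ∫ t in x..(x + 1), u t ^ 2 := intervalIntegral.integral_mono_on (by linarith)
          (by simp) ((hu.pow 2).intervalIntegrable _ _) fun t ht => hmin ht
      _ ≤ I := by
          rw [intervalIntegral.integral_of_le (by linarith)]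
          exact setIntegral_le_integral hu2 (Eventually.of_forall fun t => sq_nonneg _)
  have hdiff : |u z - u x| ≤ 1 + J := by
    have e : u z - u x = ∫ t in x..z, g t := by
      rw [hrep z, hrep x, ← intervalIntegral.integral_interval_sub_left
        (hg.intervalIntegrable_real 0 z) (hg.intervalIntegrable_real 0 x)]
      ring
    rw [e]
    calc |∫ t in x..z, g t| ≤ ∫ t in x..z, (1 + g t ^ 2) := by
          rw [← Real.norm_eq_abs]
          refine intervalIntegral.norm_integral_le_of_norm_le hz.1
            (Eventually.of_forall fun t _ => ?_)
            (intervalIntegrable_const.add hg2.intervalIntegrable)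
          rw [Real.norm_eq_abs, ← sq_abs]
          nlinarith [sq_nonneg (|g t| - 1)]
      _ = (z - x) + ∫ t in x..z, g t ^ 2 := by
          rw [intervalIntegral.integral_add intervalIntegrable_const hg2.intervalIntegrable]
          simp
      _ ≤ 1 + J := by
          refine add_le_add (by linarith [hz.2]) ?_
          rw [intervalIntegral.integral_of_le hz.1]
          exact setIntegral_le_integral hg2 (Eventually.of_forall fun t => sq_nonneg _)
  have h1 : |u z| ≤ 1 + I := by
    rw [← sq_abs] at hzI
    nlinarith [sq_nonneg (|u z| - 1)]
  have h2 : u x = u z - (u z - u x) := by ring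
  rw [h2]
  exact (abs_sub _ _).trans (add_le_add h1 hdiff)

theorem IsH1WithWeakDeriv.add_const_mul {u g φ : ℝ → ℝ} (h : IsH1WithWeakDeriv u g)
    (hφ : ContDiff ℝ ∞ φ) (hφc : HasCompactSupport φ) (t : ℝ) :
    IsH1WithWeakDeriv (fun x => u x + t * φ x) (fun x => g x + t * deriv φ x) := by
  have hφ' : Continuous (deriv φ) := hφ.continuous_deriv (by simp)
  have m1 : MemLp φ 2 volume := hφ.continuous.memLp_of_hasCompactSupport hφc
  have m2 : MemLp (deriv φ) 2 volume := hφ'.memLp_of_hasCompactSupport hφc.deriv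
  refine ⟨h.memLp.add (m1.const_mul t), h.memLp_deriv.add (m2.const_mul t), fun ψ hψ hψc => ?_⟩
  have hψ' : Continuous (deriv ψ) := hψ.continuous_deriv (by simp)
  have n1 : MemLp ψ 2 volume := hψ.continuous.memLp_of_hasCompactSupport hψc
  have n2 : MemLp (deriv ψ) 2 volume := hψ'.memLp_of_hasCompactSupport hψc.deriv
  have i1 : Integrable fun x => u x * deriv ψ x := h.memLp.integrable_mul n2
  have i2 : Integrable fun x => φ x * deriv ψ x := m1.integrable_mul n2
  have i3 : Integrable fun x => g x * ψ x := h.memLp_deriv.integrable_mul n1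
  have i4 : Integrable fun x => deriv φ x * ψ x := m2.integrable_mul n1
  have e1 : (fun x => (u x + t * φ x) * deriv ψ x) =
      fun x => u x * deriv ψ x + t * (φ x * deriv ψ x) := by funext x; ring
  have e2 : (fun x => (g x + t * deriv φ x) * ψ x) =
      fun x => g x * ψ x + t * (deriv φ x * ψ x) := by funext x; ring
  have hparts : ∫ x, φ x * deriv ψ x = -∫ x, deriv φ x * ψ x :=
    integral_mul_deriv_eq_deriv_mul_of_integrable
      (fun x _ => (hφ.differentiable (by simp) x).hasDerivAt)
      (fun x _ => (hψ.differentiable (by simp) x).hasDerivAt) i2 i4 (m1.integrable_mul n1)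
  rw [e1, e2, integral_add i1 (i2.const_mul t), integral_add i3 (i4.const_mul t),
    integral_const_mul, integral_const_mul, h.weak_deriv ψ hψ hψc, hparts]
  ring

/-! ### The Euler–Lagrange equation -/

section EulerLagrange

variable {μ f : ℝ → ℝ} {ξ a ε : ℝ} {v : ℝ → ℝ}

theorem AdmissibleData.integrable_energy (hd : AdmissibleData μ f ξ) {u g : ℝ → ℝ}
    (h : IsH1WithWeakDeriv u g) (hu : Continuous u) :
    Integrable fun x => ε / 2 * (g x) ^ 2 - 1 / (2 * ε) * μ x * (u x) ^ 2
      + 1 / (4 * ε) * (u x) ^ 4 - a * f x * u x := by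
  obtain ⟨C, hC⟩ := h.exists_bound hu
  have hu2 := h.memLp.integrable_sq
  have i1 := h.memLp_deriv.integrable_sq
  have i2 : Integrable fun x => μ x * u x ^ 2 := hu2.mul_of_top_right hd.bounded_mu
  have i3 : Integrable fun x => u x ^ 2 * u x ^ 2 := by
    refine hu2.bdd_mul (c := C ^ 2) (hu.pow 2).aestronglyMeasurable
      (Eventually.of_forall fun x => ?_)
    rw [norm_pow]
    exact pow_le_pow_left₀ (abs_nonneg _) (hC x) 2
  have i4 : Integrable fun x => u x * f x :=
    hd.integrable_f.bdd_mul (c := C) hu.aestronglyMeasurable (Eventually.of_forall hC)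
  refine ((((i1.const_mul (ε / 2)).sub (i2.const_mul (1 / (2 * ε)))).add
    (i3.const_mul (1 / (4 * ε)))).sub (i4.const_mul a)).congr (Eventually.of_forall fun x => ?_)
  simp only [Pi.add_apply, Pi.sub_apply]
  ring

theorem eq_zero_of_forall_quartic_nonneg {a₁ a₂ a₃ a₄ : ℝ}
    (h : ∀ t : ℝ, 0 ≤ t * a₁ + t ^ 2 * a₂ + t ^ 3 * a₃ + t ^ 4 * a₄) : a₁ = 0 := by
  have hmin : IsLocalMin (fun t : ℝ => t * a₁ + t ^ 2 * a₂ + t ^ 3 * a₃ + t ^ 4 * a₄) 0 :=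
    Eventually.of_forall fun t => by simpa using h t
  refine hmin.hasDerivAt_eq_zero ?_
  have := ((((hasDerivAt_id (0 : ℝ)).mul_const a₁).add
    (((hasDerivAt_id (0 : ℝ)).pow 2).mul_const a₂)).add
    (((hasDerivAt_id (0 : ℝ)).pow 3).mul_const a₃)).add
    (((hasDerivAt_id (0 : ℝ)).pow 4).mul_const a₄)
  exact this.congr_deriv (by simp)

/-- The Euler–Lagrange equation of `E`, in weak form. -/
theorem AdmissibleData.weak_eulerLagrange (hd : AdmissibleData μ f ξ) (hε : 0 < ε)
    (hv : Continuous v) {g : ℝ → ℝ} (h : IsH1WithWeakDeriv v g)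
    (hmin : ∀ u k, IsH1WithWeakDeriv u k → energy μ f a ε v g ≤ energy μ f a ε u k)
    {φ : ℝ → ℝ} (hφ : ContDiff ℝ ∞ φ) (hφc : HasCompactSupport φ) :
    ∫ x, g x * deriv φ x =
      -∫ x, (1 / ε ^ 2 * (-μ x * v x + v x ^ 3 - ε * a * f x)) * φ x := by
  have hμ : Continuous μ := hd.contDiff_mu.continuous
  have hf := hd.continuous_f
  have hφ0 := hφ.continuous
  have hφ' : Continuous (deriv φ) := hφ.continuous_deriv (by simp)
  set k : ℝ → ℝ := fun x => 1 / ε ^ 2 * (-μ x * v x + v x ^ 3 - ε * a * f x) with hk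
  have hkc : Continuous k := by fun_prop
  have j1 : Integrable fun x => g x * deriv φ x :=
    h.memLp_deriv.integrable_mul (q := 2) (hφ'.memLp_of_hasCompactSupport hφc.deriv)
  have j2 : Integrable fun x => k x * φ x :=
    (hkc.mul hφ0).integrable_of_hasCompactSupport hφc.mul_left
  have i1 : Integrable fun x => ε * (g x * deriv φ x + k x * φ x) := (j1.add j2).const_mul ε
  have i2 : Integrable fun x => ε / 2 * deriv φ x ^ 2
      + (6 / (4 * ε) * v x ^ 2 - 1 / (2 * ε) * μ x) * φ x ^ 2 := by
    refine Continuous.integrable_of_hasCompactSupport (by fun_prop) ?_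
    have c1 : HasCompactSupport fun x => ε / 2 * deriv φ x ^ 2 := by
      simp only [sq]
      exact hφc.deriv.mul_left.mul_left
    have c2 : HasCompactSupport fun x =>
        (6 / (4 * ε) * v x ^ 2 - 1 / (2 * ε) * μ x) * φ x ^ 2 := by
      simp only [sq]
      exact hφc.mul_left.mul_left
    exact c1.add c2
  have i3 : Integrable fun x => 1 / ε * v x * φ x ^ 2 * φ x :=
    Continuous.integrable_of_hasCompactSupport (by fun_prop) hφc.mul_left
  have i4 : Integrable fun x => 1 / (4 * ε) * φ x ^ 3 * φ x :=
    Continuous.integrable_of_hasCompactSupport (by fun_prop) hφc.mul_left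
  -- E(v + tφ) - E(v) is a quartic polynomial in t without constant term, nonnegative by minimality;
  -- its linear coefficient is the first variation.
  have key := eq_zero_of_forall_quartic_nonneg
    (a₁ := ∫ x, ε * (g x * deriv φ x + k x * φ x))
    (a₂ := ∫ x, (ε / 2 * deriv φ x ^ 2 + (6 / (4 * ε) * v x ^ 2 - 1 / (2 * ε) * μ x) * φ x ^ 2))
    (a₃ := ∫ x, 1 / ε * v x * φ x ^ 2 * φ x) (a₄ := ∫ x, 1 / (4 * ε) * φ x ^ 3 * φ x)
    (fun t => by
      have ht := h.add_const_mul hφ hφc t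
      have hle := hmin _ _ ht
      have k0 := hd.integrable_energy (a := a) (ε := ε) h hv
      have k1 := hd.integrable_energy (a := a) (ε := ε) ht (by fun_prop)
      unfold energy at hle
      rw [← sub_nonneg, ← integral_sub k1 k0] at hle
      rw [← integral_const_mul, ← integral_const_mul, ← integral_const_mul, ← integral_const_mul,
        ← integral_add (i1.const_mul t) (i2.const_mul _),
        ← integral_add ((i1.const_mul t).fun_add (i2.const_mul _)) (i3.const_mul _),
        ← integral_add (((i1.const_mul t).fun_add (i2.const_mul _)).fun_add (i3.const_mul _))
          (i4.const_mul _)]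
      refine hle.trans_eq (integral_congr_ae (Eventually.of_forall fun x => ?_))
      simp only [hk]
      field_simp
      ring)
  rw [integral_const_mul, integral_add j1 j2] at key
  have := (mul_eq_zero.1 key).resolve_left hε.ne'
  linarith

/-- Global minimizers are classical solutions of the Euler–Lagrange equation. -/
theorem IsGlobalMinimizer.exists_hasDerivAt (hd : AdmissibleData μ f ξ) (hε : 0 < ε)
    (hv : IsGlobalMinimizer μ f a ε v) :
    ∃ z : ℝ → ℝ, ∀ x, HasDerivAt v (z x) x ∧
      HasDerivAt z (1 / ε ^ 2 * (-μ x * v x + v x ^ 3 - ε * a * f x)) x := by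
  obtain ⟨hvc, g, h, hmin⟩ := hv
  have hμ : Continuous μ := hd.contDiff_mu.continuous
  have hf := hd.continuous_f
  set k : ℝ → ℝ := fun x => 1 / ε ^ 2 * (-μ x * v x + v x ^ 3 - ε * a * f x) with hk
  have hkc : Continuous k := by fun_prop
  have hkl : LocallyIntegrable k := hkc.locallyIntegrable
  have hg : LocallyIntegrable g := h.memLp_deriv.locallyIntegrable (by norm_num)
  have hKc := hkl.continuous_primitive_real
  -- The weak derivative g and the primitive of k have the same weak derivative k, so g agrees
  -- almost everywhere with a C¹ function.
  obtain ⟨c, hc⟩ := exists_ae_eq_const_of_integral_mul_deriv_eq_zero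
    (hg.sub hKc.locallyIntegrable) fun φ hφ hφc => by
      have hφ' : Continuous (deriv φ) := hφ.continuous_deriv (by simp)
      simp only [Pi.sub_apply, sub_mul]
      rw [integral_sub, hd.weak_eulerLagrange hε hvc h hmin hφ hφc,
        integral_primitive_mul_deriv hkl hφ hφc, sub_self]
      · exact h.memLp_deriv.integrable_mul (q := 2) (hφ'.memLp_of_hasCompactSupport hφc.deriv)
      · exact (hKc.mul hφ').integrable_of_hasCompactSupport hφc.deriv.mul_left
  set z : ℝ → ℝ := fun x => (∫ t in (0 : ℝ)..x, k t) + c with hz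
  have hzc : Continuous z := hKc.add continuous_const
  have hgz : g =ᵐ[volume] z := by
    filter_upwards [hc] with x hx
    simp only [Pi.sub_apply] at hx
    simp only [hz]; linarith
  have hrep : ∀ x, v x = v 0 + ∫ t in (0 : ℝ)..x, z t := fun x => by
    rw [eq_add_primitive_of_weak_deriv hvc hg h.weak_deriv x]
    congr 1
    exact intervalIntegral.integral_congr_ae (hgz.mono fun t ht _ => ht)
  have hprim : ∀ {q : ℝ → ℝ}, Continuous q → ∀ x,
      HasDerivAt (fun x => ∫ t in (0 : ℝ)..x, q t) (q x) x := fun hq x =>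
    intervalIntegral.integral_hasDerivAt_right (hq.intervalIntegrable _ _)
      (hq.stronglyMeasurableAtFilter _ _) hq.continuousAt
  refine ⟨z, fun x => ⟨?_, (hprim hkc x).add_const c⟩⟩
  rw [funext hrep]
  exact (hprim hzc x).const_add _

end EulerLagrange

/-! ### Rescaling near ξ -/

/-- The length scale `h` and the amplitude `κ` of the rescaling. -/
theorem rescaledProfile_scales {m ε : ℝ} (hm : 0 < m) (hε : 0 < ε) :
    0 < ε ^ (2 / 3 : ℝ) / m ^ (1 / 3 : ℝ) ∧
    0 < (2 : ℝ) ^ (-(1 / 2) : ℝ) * (m * ε) ^ (-(1 / 3) : ℝ) ∧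
    m * (ε ^ (2 / 3 : ℝ) / m ^ (1 / 3 : ℝ)) ^ 3 = ε ^ 2 ∧
    √2 * ε * ((2 : ℝ) ^ (-(1 / 2) : ℝ) * (m * ε) ^ (-(1 / 3) : ℝ)) =
      ε ^ (2 / 3 : ℝ) / m ^ (1 / 3 : ℝ) := by
  refine ⟨by positivity, by positivity, ?_, ?_⟩
  · rw [div_pow, ← Real.rpow_natCast, ← Real.rpow_natCast, ← Real.rpow_mul hε.le,
      ← Real.rpow_mul hm.le]
    norm_num
    field_simp
  · have h2 : √2 * (2 : ℝ) ^ (-(1 / 2) : ℝ) = 1 := by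
      rw [Real.sqrt_eq_rpow, ← Real.rpow_add two_pos]; norm_num
    rw [Real.mul_rpow hm.le hε.le, Real.rpow_neg hm.le]
    have h3 : ε * ε ^ (-(1 / 3) : ℝ) = ε ^ (2 / 3 : ℝ) := by
      nth_rewrite 1 [← Real.rpow_one ε]
      rw [← Real.rpow_add hε]; norm_num
    calc _ = (√2 * (2 : ℝ) ^ (-(1 / 2) : ℝ)) * (ε * ε ^ (-(1 / 3) : ℝ)) * (m ^ (1 / 3 : ℝ))⁻¹ := by
          ring
      _ = _ := by rw [h2, h3]; ring

theorem tendsto_lengthScale (m : ℝ) :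
    Tendsto (fun ε : ℝ => ε ^ (2 / 3 : ℝ) / m ^ (1 / 3 : ℝ)) (𝓝[>] 0) (𝓝 0) := by
  have h : Tendsto (fun ε : ℝ => ε ^ (2 / 3 : ℝ)) (𝓝 0) (𝓝 ((0 : ℝ) ^ (2 / 3 : ℝ))) :=
    (Real.continuousAt_rpow_const 0 (2 / 3) (Or.inr (by norm_num))).tendsto
  rw [Real.zero_rpow (by norm_num)] at h
  simpa using (h.mono_left nhdsWithin_le_nhds).div_const (m ^ (1 / 3 : ℝ))

section Rescaling

variable {μ f : ℝ → ℝ} {ξ a : ℝ}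

theorem AdmissibleData.f_xi_pos (hd : AdmissibleData μ f ξ) : 0 < f ξ := hd.f_pos ξ hd.xi_pos

theorem AdmissibleData.neg_deriv_pos (hd : AdmissibleData μ f ξ) : 0 < -deriv μ ξ :=
  neg_pos.2 (hd.deriv_mu_neg ξ hd.xi_pos)

/-- The rescaled profile of a solution of the Euler–Lagrange equation solves a perturbed
Painlevé equation. -/
theorem AdmissibleData.rescaledProfile_hasDerivAt (hd : AdmissibleData μ f ξ) {ε : ℝ}
    (hε : 0 < ε) {v z : ℝ → ℝ} (hv : ∀ x, HasDerivAt v (z x) x ∧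
      HasDerivAt z (1 / ε ^ 2 * (-μ x * v x + v x ^ 3 - ε * a * f x)) x)
    {h : ℝ} (hh : h = ε ^ (2 / 3 : ℝ) / (-deriv μ ξ) ^ (1 / 3 : ℝ)) :
    ∃ w₁ : ℝ → ℝ, ∀ s, HasDerivAt (rescaledProfile μ ξ 1 ε v) (w₁ s) s ∧
      HasDerivAt w₁ (-(μ (ξ + h * s) / (-deriv μ ξ * h)) * rescaledProfile μ ξ 1 ε v s
        + 2 * rescaledProfile μ ξ 1 ε v s ^ 3
        - a * f (ξ + h * s) / (√2 * -deriv μ ξ)) s := by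
  set m := -deriv μ ξ with hm
  obtain ⟨h1, h2, h3, h4⟩ := rescaledProfile_scales hd.neg_deriv_pos hε
  have hm0 := hd.neg_deriv_pos
  rw [← hm] at h1 h2 h3 h4 hm0
  rw [← hh] at h1 h3 h4
  set κ := (2 : ℝ) ^ (-(1 / 2) : ℝ) * (m * ε) ^ (-(1 / 3) : ℝ) with hκ
  have hw : ∀ s, rescaledProfile μ ξ 1 ε v s = κ * v (ξ + h * s) := fun s => by
    simp only [rescaledProfile, ← hm, one_mul, ← hκ]
    congr 2
    rw [hh]; ring
  have haff : ∀ s, HasDerivAt (fun s => ξ + h * s) h s := fun s => by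
    simpa using ((hasDerivAt_id s).const_mul h).const_add ξ
  refine ⟨fun s => κ * (z (ξ + h * s) * h), fun s => ⟨?_, ?_⟩⟩
  · rw [funext hw]
    exact ((hv _).1.comp s (haff s)).const_mul κ
  · refine ((((hv _).2.comp s (haff s)).mul_const h).const_mul κ).congr_deriv ?_
    rw [hw]
    have hs2 : √2 ^ 2 = 2 := Real.sq_sqrt (by norm_num)
    have hs0 : 0 < √2 := by positivity
    have hε2 : 1 / ε ^ 2 = 1 / (m * h ^ 3) := by rw [h3]
    generalize v (ξ + h * s) = V
    generalize μ (ξ + h * s) = X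
    generalize f (ξ + h * s) = Y
    -- The factor h² / ε² takes two useful forms: 1 / (m h) normalizes the slope of μ at ξ, and 2 κ²
    -- gives the cubic coefficient 2.
    have e1 : 1 / ε ^ 2 * h ^ 2 = 1 / (m * h) := by rw [hε2]; field_simp
    have e2 : 1 / ε ^ 2 * h ^ 2 = 2 * κ ^ 2 := by
      rw [← h4, mul_pow, mul_pow, hs2]; field_simp
    have e3 : κ * h ^ 2 / ε = 1 / (√2 * m) := by
      have : κ = h / (√2 * ε) := by rw [← h4]; field_simp
      rw [this]
      rw [div_mul_eq_mul_div, div_div, div_eq_div_iff (by positivity) (by positivity)]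
      linear_combination √2 * h3
    calc κ * (1 / ε ^ 2 * (-X * V + V ^ 3 - ε * a * Y) * h * h)
        = -X * (1 / ε ^ 2 * h ^ 2) * (κ * V) + (1 / ε ^ 2 * h ^ 2) * (κ * V ^ 3)
          - a * Y * (κ * h ^ 2 / ε) := by field_simp
      _ = -X * (1 / (m * h)) * (κ * V) + 2 * κ ^ 2 * (κ * V ^ 3) - a * Y * (1 / (√2 * m)) := by
          rw [e3]; nth_rewrite 2 [e2]; rw [e1]
      _ = _ := by ring

/-- Differentiability of μ at ξ gives -μ(ξ + h s) / (m h) → s uniformly for |s| ≤ R, and continuity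
of f handles the forcing term. -/
theorem AdmissibleData.approxPainleveODE (hd : AdmissibleData μ f ξ) (ha : 0 < a)
    {v : ℝ → ℝ → ℝ} (hv : ∀ᶠ ε in 𝓝[>] (0 : ℝ), (∃ z : ℝ → ℝ, ∀ x, HasDerivAt (v ε) (z x) x ∧
      HasDerivAt z (1 / ε ^ 2 * (-μ x * v ε x + v ε x ^ 3 - ε * a * f x)) x) ∧
      ∀ x, 0 ≤ x → 0 ≤ v ε x) :
    ApproxPainleveODE (𝓝[>] (0 : ℝ)) (a * f ξ / (√2 * -deriv μ ξ))
      (fun ε => rescaledProfile μ ξ 1 ε (v ε)) (fun ε => deriv (rescaledProfile μ ξ 1 ε (v ε)))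
      (fun ε => deriv (deriv (rescaledProfile μ ξ 1 ε (v ε)))) := by
  intro R δ hδ
  have hm := hd.neg_deriv_pos
  set m := -deriv μ ξ with hmdef
  have hlim := tendsto_lengthScale m
  have hμd : HasDerivAt μ (-m) ξ := by
    rw [hmdef, neg_neg]
    exact (hd.contDiff_mu.differentiable (by norm_num) ξ).hasDerivAt
  set c := δ * m / (|R| + 1) with hc
  have hc0 : 0 < c := by positivity
  have hμ1 := (hasDerivAt_iff_isLittleO.1 hμd).def hc0
  obtain ⟨r₁, hr₁, hb₁⟩ := Metric.eventually_nhds_iff.1 hμ1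
  obtain ⟨r₂, hr₂, hb₂⟩ := Metric.continuousAt_iff.1 (hd.continuous_f.continuousAt (x := ξ))
    (δ * (√2 * m) / a) (by positivity)
  -- Including ξ in the minimum keeps ξ + h s positive, where v is known to be nonnegative.
  have hr : 0 < min r₁ (min r₂ ξ) / (|R| + 1) :=
    div_pos (lt_min hr₁ (lt_min hr₂ hd.xi_pos)) (by positivity)
  filter_upwards [hv, self_mem_nhdsWithin, hlim.eventually_lt_const hr] with
    ε ⟨⟨z, hz⟩, hpos⟩ hε hsmall s hs
  obtain ⟨w₁, hw⟩ := hd.rescaledProfile_hasDerivAt hε hz rfl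
  obtain ⟨h0, hκ, h3, -⟩ := rescaledProfile_scales hm hε
  rw [← hmdef] at hw
  set h := ε ^ (2 / 3 : ℝ) / m ^ (1 / 3 : ℝ) with hh
  set w := rescaledProfile μ ξ 1 ε (v ε) with hwdef
  have hd1 : deriv w = w₁ := funext fun s => (hw s).1.deriv
  rw [hd1, (hw s).2.deriv]
  have hsR : |s| ≤ |R| := hs.trans (le_abs_self R)
  have hhs : |h * s| < min r₁ (min r₂ ξ) := by
    rw [abs_mul, abs_of_pos h0]
    rw [lt_div_iff₀ (by positivity)] at hsmall
    nlinarith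
  have hw0 : 0 ≤ w s := by
    have hx : 0 ≤ ξ + h * s := by
      have := hhs.trans_le ((min_le_right _ _).trans (min_le_right _ _))
      linarith [(abs_lt.1 this).1]
    simp only [hwdef, rescaledProfile, one_mul, ← hmdef]
    refine mul_nonneg hκ.le (hpos _ ?_)
    convert hx using 2
    rw [hh]; ring
  refine ⟨hw0, (hw s).1, (hw s).2, ?_⟩
  have k1 : |-(μ (ξ + h * s) / (m * h)) - s| ≤ δ := by
    have := hb₁ (y := ξ + h * s) (by
      rw [Real.dist_eq, add_sub_cancel_left]
      exact hhs.trans_le (min_le_left _ _))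
    rw [hd.mu_xi, add_sub_cancel_left, Real.norm_eq_abs, Real.norm_eq_abs] at this
    have e : -(μ (ξ + h * s) / (m * h)) - s = -(μ (ξ + h * s) - 0 - (h * s) • -m) / (m * h) := by
      rw [smul_eq_mul]; field_simp; ring
    rw [e, abs_div, abs_neg, abs_of_pos (mul_pos hm h0), div_le_iff₀ (mul_pos hm h0)]
    refine this.trans ?_
    rw [abs_mul, abs_of_pos h0, hc, div_mul_eq_mul_div, div_le_iff₀ (by positivity)]
    have : 0 ≤ δ * m * h := by positivity
    nlinarith
  have k2 : |a * f (ξ + h * s) / (√2 * m) - a * f ξ / (√2 * m)| ≤ δ := by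
    have := hb₂ (x := ξ + h * s) (by
      rw [Real.dist_eq, add_sub_cancel_left]
      exact hhs.trans_le ((min_le_right _ _).trans (min_le_left _ _)))
    rw [Real.dist_eq] at this
    rw [← sub_div, ← mul_sub, abs_div, abs_mul, abs_of_pos ha,
      abs_of_pos (by positivity : 0 < √2 * m), div_le_iff₀ (by positivity)]
    rw [lt_div_iff₀ ha] at this
    linarith
  have e : -(μ (ξ + h * s) / (m * h)) * w s + 2 * w s ^ 3 - a * f (ξ + h * s) / (√2 * m)
      - (s * w s + 2 * w s ^ 3 - a * f ξ / (√2 * m)) =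
      (-(μ (ξ + h * s) / (m * h)) - s) * w s
        - (a * f (ξ + h * s) / (√2 * m) - a * f ξ / (√2 * m)) := by ring
  rw [e]
  refine (abs_sub _ _).trans ?_
  rw [abs_mul, abs_of_nonneg hw0]
  nlinarith

theorem AdmissibleData.tendstoC1Loc (hd : AdmissibleData μ f ξ) (ha : 0 < a)
    {v : ℝ → ℝ → ℝ} (hv : ∀ᶠ ε in 𝓝[>] (0 : ℝ), (∃ z : ℝ → ℝ, ∀ x, HasDerivAt (v ε) (z x) x ∧
      HasDerivAt z (1 / ε ^ 2 * (-μ x * v ε x + v ε x ^ 3 - ε * a * f x)) x) ∧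
      ∀ x, 0 ≤ x → 0 ≤ v ε x) {y z : ℝ → ℝ}
    (hy : PainleveODE (a * f ξ / (√2 * -deriv μ ξ)) y z) (hy0 : ∀ s, 0 ≤ y s) :
    TendstoC1Loc (fun ε => rescaledProfile μ ξ 1 ε (v ε)) y := by
  have hβ : 0 < a * f ξ / (√2 * -deriv μ ξ) := by
    have := hd.f_xi_pos
    have := hd.neg_deriv_pos
    positivity
  obtain ⟨h1, h2⟩ := (hd.approxPainleveODE ha hv).tendstoLocallyUniformly hβ hy hy0
  refine ⟨contDiff_one_of_hasDerivAt hy.hasDerivAt hy.continuous_deriv, ?_, h1,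
    hy.deriv_eq ▸ h2⟩
  filter_upwards [hv, self_mem_nhdsWithin] with ε ⟨⟨z, hz⟩, _⟩ hε
  obtain ⟨w₁, hw⟩ := hd.rescaledProfile_hasDerivAt hε hz rfl
  exact contDiff_one_of_hasDerivAt (fun s => (hw s).1)
    (continuous_iff_continuousAt.2 fun s => (hw s).2.continuousAt)

end Rescaling

/-! ### Conclusion -/

theorem mainTheorem4 (μ f : ℝ → ℝ) (ξ a : ℝ) (hdata : AdmissibleData μ f ξ) (ha : 0 < a) :
    (∃! y : ℝ → ℝ, IsPositiveDecreasingPainleve (a * f ξ / (√2 * deriv μ ξ)) y) ∧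
    ∀ y : ℝ → ℝ, IsPositiveDecreasingPainleve (a * f ξ / (√2 * deriv μ ξ)) y →
      (∀ v : ℝ → ℝ → ℝ,
        (∀ᶠ ε in 𝓝[>] (0 : ℝ), IsGlobalMinimizer μ f a ε (v ε) ∧ ∀ x, 0 ≤ x → 0 ≤ v ε x) →
        TendstoC1Loc (fun ε => rescaledProfile μ ξ 1 ε (v ε)) y) ∧
      (∀ v : ℝ → ℝ → ℝ,
        (∀ᶠ ε in 𝓝[>] (0 : ℝ), IsGlobalMinimizer μ f a ε (v ε) ∧ ∀ x, x ≤ 0 → v ε x ≤ 0) →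
        TendstoC1Loc (fun ε => rescaledProfile μ ξ (-1) ε (v ε)) y) := by
  have hf := hdata.f_xi_pos
  have hm := hdata.neg_deriv_pos
  have hα : a * f ξ / (√2 * deriv μ ξ) = -(a * f ξ / (√2 * -deriv μ ξ)) := by
    rw [mul_neg, div_neg, neg_neg]
  have hβ : 0 < a * f ξ / (√2 * -deriv μ ξ) := by positivity
  rw [hα]
  have hode : ∀ y : ℝ → ℝ, IsPositiveDecreasingPainleve (-(a * f ξ / (√2 * -deriv μ ξ))) y →
      PainleveODE (a * f ξ / (√2 * -deriv μ ξ)) y (deriv y) := fun y hy => by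
    simpa only [neg_neg] using hy.minimal.1.painleveODE
  refine ⟨?_, fun y hy => ⟨fun v hv => ?_, fun v hv => ?_⟩⟩
  · obtain ⟨y, z, hyz, hy⟩ := exists_nonneg_painleveODE hβ
    exact ⟨y, hyz.isPositiveDecreasing hβ hy, fun y₂ hy₂ =>
      hyz.eq_of_nonneg hβ hy (hode y₂ hy₂) fun s => (hy₂.pos s).le⟩
  · refine hdata.tendstoC1Loc ha ?_ (hode y hy) fun s => (hy.pos s).le
    filter_upwards [hv, self_mem_nhdsWithin] with ε hvε hε
    exact ⟨hvε.1.exists_hasDerivAt hdata hε, hvε.2⟩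
  -- Since μ is even and f is odd, x ↦ -v(-x) solves the same Euler–Lagrange equation and is
  -- nonnegative on [0, ∞).
  · have hrefl : (fun ε => rescaledProfile μ ξ (-1) ε (v ε)) =
        fun ε => rescaledProfile μ ξ 1 ε fun x => -v ε (-x) := by
      funext ε s
      simp only [rescaledProfile]
      rw [show -(1 * ξ + 1 * ε ^ (2 / 3 : ℝ) * (s / (-deriv μ ξ) ^ (1 / 3 : ℝ))) =
        -1 * ξ + -1 * ε ^ (2 / 3 : ℝ) * (s / (-deriv μ ξ) ^ (1 / 3 : ℝ)) by ring]
      ring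
    rw [hrefl]
    refine hdata.tendstoC1Loc ha ?_ (hode y hy) fun s => (hy.pos s).le
    filter_upwards [hv, self_mem_nhdsWithin] with ε hvε hε
    obtain ⟨z, hz⟩ := hvε.1.exists_hasDerivAt hdata hε
    refine ⟨⟨fun x => z (-x), fun x => ⟨?_, ?_⟩⟩, fun x hx => ?_⟩
    · exact ((hz (-x)).1.comp x (hasDerivAt_neg x)).neg.congr_deriv (by simp)
    · refine ((hz (-x)).2.comp x (hasDerivAt_neg x)).congr_deriv ?_
      rw [hdata.even_mu, hdata.odd_f]
      ring
    · exact neg_nonneg.2 (hvε.2 (-x) (by linarith))
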